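/- Notation. $(D_e)_{e\in\omega}$ is the canonical enumeration of the finite subsets of $\omega$, and $A\le_e B$ means that there is a c.e. set $\Phi$ with $n\in A\iff\exists e\,[\langle n,e\rangle\in\Phi$ and $D_e\subseteq B]$; $\equiv_e$ is the induced equivalence. For $P,Q\subseteq\omega^\omega$, $P\le_M Q$ means that one partial computable functional maps every element of $Q$ to an element of $P$; $\equiv_M$ is the induced equivalence. For $E\subseteq\omega$ let $\mathrm{Enum}(E)=\{p\in\omega^\omega:\mathrm{rng}(p)=E\}$, and for $A,B\subseteq\omega$ let $\mathrm{Sep}(A,B)=\{C\subseteq\omega: A\subseteq C,\ B\cap C=\emptyset\}$, where sets are identified with their characteristic functions. We say that $\mathrm{Sep}(A,B)$ enumerates $E$ if there is a single index $e$ with $W_e^{C}=E$ for all $C\in\mathrm{Sep}(A,B)$, where $W_e^C$ is the $e$-th set c.e. relative to $C$. A represented countably based space is a topological space $S$ with an enumeration $\beta=(\beta_e)_{e\in\omega}$ of an open subbasis. For $y\in S$ put $\mathrm{Nbase}(y)=\{e:y\in\beta_e\}$; the point $y$ is computable if $\mathrm{Nbase}(y)$ is c.e. The space is effectively Hausdorff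 if the complement of the diagonal is c.e. open in $S\times S$, i.e. there is a c.e. set $H$ of pairs of finite sets $D,D'\subseteq\omega$ with $\{(y,z):y\neq z\}=\bigcup_{(D,D')\in H}\big(\bigcap_{e\in D}\beta_e\times\bigcap_{e\in D'}\beta_e\big)$. The telophase space $\hat\omega_{TP}$ is $\omega\cup\{\infty,\infty_\star\}$ with the subbasis consisting of the sets $\{m\}$, $[m,\infty]=\{k\in\omega:k\ge m\}\cup\{\infty\}$ and $[m,\infty_\star]=\{k\in\omega:k\ge m\}\cup\{\infty_\star\}$ for $m\in\omega$; its $\omega$-power $(\hat\omega_{TP})^\omega$ has the induced subbasis, indexed by triples $\langle n,i,m\rangle$ with $i<3$, which say that the $n$-th coordinate lies in $\{m\}$, $[m,\infty]$ or $[m,\infty_\star]$, respectively. An $e$-degree is telograph-cototal if it contains $\omega\setminus\{\langle n,g(n)\rangle:n\in\omega\}\ \oplus\ \{\langle n,g(n)\rangle:g(n)\ge b\}$ for some $g:\omega\to\omega$ and $b\in\omega$. Theorem. Let $\{S_i\}_{i\in I}$ be a countable family of effectively Hausdorff represented countably based spaces (no uniformity in $i$ is assumed). Then there are a point $x\in(\hat\omega_{TP})^\omega$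 and sets $A,B\subseteq\omega$ such that 1. the $e$-degree of $\mathrm{Nbase}(x)$ is telograph-cototal; 2. the $e$-degree of $\mathrm{Nbase}(x)$ is $S_i$-quasi-minimal for every $i\in I$: $\mathrm{Nbase}(x)$ is not c.e., and for every $i\in I$ and every $y\in S_i$, if $\mathrm{Nbase}(y)\le_e\mathrm{Nbase}(x)$ then $y$ is computable; 3. $A\cap B=\emptyset$, $A\cup B$ is co-c.e., and $\mathrm{Enum}(\mathrm{Nbase}(x))\equiv_M\mathrm{Sep}(A,B)$; 4. for every $i\in I$, $\mathrm{Sep}(A,B)$ enumerates $\mathrm{Nbase}(y)$ for no non-computable point $y$ of $S_i$. -/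

import Mathlib

/-! ### Computably enumerable sets and enumeration reducibility -/

/-- `A` is computably enumerable. -/
def CE {α : Type*} [Primcodable α] (A : Set α) : Prop :=
  REPred fun a => a ∈ A

/-- The enumeration operator with axiom set `Φ`: a pair `(n, D)` in `Φ` says that `n` is enumerated
once all members of the finite set listed by `D` have been. -/
def enumOp (Φ : Set (ℕ × List ℕ)) (B : Set ℕ) : Set ℕ :=
  {n | ∃ D : List ℕ, (n, D) ∈ Φ ∧ ∀ k ∈ D, k ∈ B}

/-- Enumeration reducibility `A ≤ₑ B`. -/
def EnumLE (A B : Set ℕ) : Prop :=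
  ∃ Φ : Set (ℕ × List ℕ), CE Φ ∧ A = enumOp Φ B

/-- Enumeration equivalence: `A` and `B` have the same enumeration degree. -/
def EnumEquiv (A B : Set ℕ) : Prop :=
  EnumLE A B ∧ EnumLE B A

/-- The join `A ⊕ B`. -/
def setJoin (A B : Set ℕ) : Set ℕ :=
  {k | (∃ n ∈ A, k = 2 * n) ∨ (∃ n ∈ B, k = 2 * n + 1)}

/-! ### Medvedev reducibility -/

/-- The Turing functional with axiom set `Φ` is defined on the oracle `p` with value `q`:
an axiom `(σ, n, m)` says that the output at `n` is `m` on every oracle extending the string `σ`. -/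
def FunctionalMaps (Φ : Set (List ℕ × ℕ × ℕ)) (p q : ℕ → ℕ) : Prop :=
  ∀ n m : ℕ, q n = m ↔ ∃ k : ℕ, ((List.range k).map p, n, m) ∈ Φ

/-- Medvedev reducibility `P ≤_M Q`: one partial computable functional maps all of `Q` into `P`. -/
def MedvedevLE (P Q : Set (ℕ → ℕ)) : Prop :=
  ∃ Φ : Set (List ℕ × ℕ × ℕ), CE Φ ∧ ∀ q ∈ Q, ∃ p ∈ P, FunctionalMaps Φ q p

def MedvedevEquiv (P Q : Set (ℕ → ℕ)) : Prop :=
  MedvedevLE P Q ∧ MedvedevLE Q P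

/-- The set of all enumerations of `E`. -/
def Enum (E : Set ℕ) : Set (ℕ → ℕ) :=
  {p | Set.range p = E}

/-- The sets separating `A` from `B`. -/
def SepSets (A B : Set ℕ) : Set (Set ℕ) :=
  {C | A ⊆ C ∧ B ∩ C = ∅}

/-- The characteristic function of `C`, a point of `2^ω ⊆ ω^ω`. -/
noncomputable def charFun (C : Set ℕ) : ℕ → ℕ :=
  C.indicator fun _ => 1

/-- `SepSets A B` enumerates `E`: for a single index `e`, the set `W_e^C`, computably enumerable
relative to `C ⊕ Cᶜ`, equals `E` for all `C` separating `A` from `B`. -/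
def SepEnumerates (A B E : Set ℕ) : Prop :=
  ∃ Φ : Set (ℕ × List ℕ), CE Φ ∧ ∀ C ∈ SepSets A B, enumOp Φ (setJoin C Cᶜ) = E

/-! ### Represented countably based spaces -/

/-- The coded neighbourhood filter of `x`. -/
def Nbase {X : Type*} (β : ℕ → Set X) (x : X) : Set ℕ :=
  {e | x ∈ β e}

/-- The basic open set given by a finite list of indices of subbasic open sets. -/
def basicOpen {X : Type*} (β : ℕ → Set X) (σ : List ℕ) : Set X :=
  {x | ∀ e ∈ σ, x ∈ β e}

/-- The countably based space `X`, represented by `β`, is effectively Hausdorff: `β` enumerates an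
open subbasis of `X`, and the complement of the diagonal is computably enumerable open in `X × X`.
In particular, `X` is Hausdorff. -/
structure IsEffectiveHausdorff (X : Type*) [TopologicalSpace X] (β : ℕ → Set X) : Prop where
  subbasis : ‹TopologicalSpace X› = TopologicalSpace.generateFrom (Set.range β)
  diagonal : ∃ H : Set (List ℕ × List ℕ), CE H ∧
    (Set.diagonal X)ᶜ = ⋃ p ∈ H, basicOpen β p.1 ×ˢ basicOpen β p.2

/-- The enumeration degree of `E` is quasi-minimal with respect to the family `S`: it is nonzero,
and every point of every `S i` that is reducible to `E` is computable. -/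
def IsQuasiMinimal {ι : Type*} (S : ι → Type*) (β : ∀ i, ℕ → Set (S i)) (E : Set ℕ) : Prop :=
  ¬ CE E ∧ ∀ (i : ι) (y : S i), EnumLE (Nbase (β i) y) E → CE (Nbase (β i) y)

/-! ### Telograph-cototal degrees and the telophase space -/

def graphSet (g : ℕ → ℕ) : Set ℕ :=
  {k | ∃ n, k = Nat.pair n (g n)}

def telograph (b : ℕ) (g : ℕ → ℕ) : Set ℕ :=
  {k | ∃ n, k = Nat.pair n (g n) ∧ b ≤ g n}

/-- The enumeration degree of `E` is telograph-cototal. -/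
def IsTelographCototal (E : Set ℕ) : Prop :=
  ∃ (g : ℕ → ℕ) (b : ℕ), EnumEquiv E (setJoin (graphSet g)ᶜ (telograph b g))

/-- The points of the telophase space: `ω` with two points at infinity, `∞` and `∞⋆`. -/
inductive Telophase : Type
  | fin (k : ℕ)
  | inf
  | infStar

/-- The subbasis of the telophase space consisting, for `m : ℕ`, of the sets `{m}` (`i = 0`),
`[m, ∞]` (`i = 1`) and `[m, ∞⋆]` (`i = 2`); for `i ≥ 3` the set is empty. -/
def Telophase.sub : ℕ → ℕ → Set Telophase
  | 0, m => {Telophase.fin m}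
  | 1, m => {z | z = Telophase.inf ∨ ∃ k, m ≤ k ∧ z = Telophase.fin k}
  | 2, m => {z | z = Telophase.infStar ∨ ∃ k, m ≤ k ∧ z = Telophase.fin k}
  | _, _ => ∅

/-- The subbasis of the `ω`-power of the telophase space; the index `e` codes a triple
`⟨n, i, m⟩`, which stands for the condition `x n ∈ Telophase.sub i m`. -/
def telophasePowerBase (e : ℕ) : Set (ℕ → Telophase) :=
  {x | x e.unpair.1 ∈ Telophase.sub e.unpair.2.unpair.1 e.unpair.2.unpair.2}

/-!
The coordinates of the point `x` are governed by a computable construction in stages. At stage `t`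
it treats one requirement, coded by `f t`, of level `lev (f t)`; this kills every number `n < t`
whose own requirement `f n` has at least that level. A number killed at stage `m` becomes a
coordinate with value `m`, and a number that survives for ever becomes a coordinate with value `∞`
or `∞⋆`, according to a set `C` that is free to choose. Killing is a computable event, so the
surviving numbers form a co-c.e. set `P`, whatever `C` is. Every level is treated only finitely
often, so `P` is infinite (`finite_lev`, `exists_surv_ge`).

A level is an enumeration operator `Φ` together with a c.e. set `H` of pairs of basic open sets that
are declared disjoint. A requirement of this level fixes an assignment of `∞` and `∞⋆` to the
living numbers of lower level, and waits for two extensions of it from which `Φ` enumerates the two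
members of some pair in `H`. When it is treated, all other numbers on which the extensions might
differ are killed. The sets `[m, ∞]` and `[m, ∞⋆]` have common finite members, and a killed number
gets a value larger than every `m` mentioned so far, so afterwards both extensions are correct about
every point that respects the assignment (`forces_of_act`). Hence `Φ` enumerates two disjoint basic
open sets from each of these points, and no point of a Hausdorff space is reducible to them by `Φ`.

If the requirement is never treated, the extensions of the assignment never split, so `Φ` gives the
same point `y` of the space from all of them, as far as it gives points. What `Φ` enumerates from
some extension is c.e., because a surviving number may be sent to either infinite value
(`ce_biUnion_enumOp`). So, if `y` is not computable, some extension makes `Φ` enumerate a number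
outside the neighbourhood filter of `y`, and a finite part of that extension excludes `y`. This makes
success dense (`dense_reducible_ce`), and as there are only countably many operators and spaces, the
finite extension method yields `C` (`exists_isQuasiMinimal`). The family enters only into the choice
of `C`, and the stage construction treats all c.e. sets `H`; so no uniformity is needed.

Put `A = P ∩ C` and `B = P \ C`. A separating set decides at every stage how to describe the
coordinates still alive, and thus enumerates the filter of `x`; conversely, which of `[0, ∞]` and
`[0, ∞⋆]` is listed first at each coordinate gives a separating set. A finite part of a separating
set can be certified by the filter of `x`, so what all separating sets enumerate uniformly is
reducible to that filter (`SepEnumerates.enumLE_pointBase`), and quasi-minimality applies.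
-/

/-! ### Primitive recursive normal form of computably enumerable predicates -/

section Toolkit

variable {α β γ : Type*} [Primcodable α] [Primcodable β] [Primcodable γ]

theorem PrimrecPred.ball_list {L : α → List β} {R : α → β → Prop} (hL : Primrec L)
    (hR : PrimrecPred fun q : α × β => R q.1 q.2) : PrimrecPred fun a => ∀ b ∈ L a, R a b :=
  (PrimrecRel.forall_mem_list (R := fun b a => R a b) (PrimrecRel.swap hR)).comp hL Primrec.id

theorem PrimrecPred.bex_list {L : α → List β} {R : α → β → Prop} (hL : Primrec L)
    (hR : PrimrecPred fun q : α × β => R q.1 q.2) : PrimrecPred fun a => ∃ b ∈ L a, R a b :=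
  (PrimrecRel.exists_mem_list (R := fun b a => R a b) (PrimrecRel.swap hR)).comp hL Primrec.id

theorem PrimrecPred.ball_lt {f : α → ℕ} {R : α → ℕ → Prop} (hf : Primrec f)
    (hR : PrimrecPred fun q : α × ℕ => R q.1 q.2) : PrimrecPred fun a => ∀ k < f a, R a k :=
  (PrimrecPred.ball_list (Primrec.list_range.comp hf) hR).of_eq fun a => by simp

theorem PrimrecPred.bex_lt {f : α → ℕ} {R : α → ℕ → Prop} (hf : Primrec f)
    (hR : PrimrecPred fun q : α × ℕ => R q.1 q.2) : PrimrecPred fun a => ∃ k < f a, R a k :=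
  (PrimrecPred.bex_list (Primrec.list_range.comp hf) hR).of_eq fun a => by simp

theorem PrimrecPred.imp {p q : α → Prop} (hp : PrimrecPred p) (hq : PrimrecPred q) :
    PrimrecPred fun a => p a → q a :=
  (hp.not.or hq).of_eq fun _ => imp_iff_not_or.symm

theorem PrimrecPred.mem_list [DecidableEq β] {g : α → β} {L : α → List β} (hg : Primrec g)
    (hL : Primrec L) : PrimrecPred fun a => g a ∈ L a :=
  (PrimrecPred.bex_list (R := fun a b => g a = b) hL
    (Primrec.eq.comp (hg.comp Primrec.fst) Primrec.snd)).of_eq fun a => by simp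

/-- The `c`-th computably enumerable subset of `α`. -/
def ceSet (α : Type*) [Primcodable α] (c : Nat.Partrec.Code) : Set α :=
  {a | ∃ k, (c.evaln k (Encodable.encode a)).isSome}

theorem REPred.exists_code {p : α → Prop} (hp : REPred p) :
    ∃ c, ∀ a, p a ↔ a ∈ ceSet α c := by
  obtain ⟨c, hc⟩ := Nat.Partrec.Code.exists_code.1 hp
  refine ⟨c, fun a => ?_⟩
  have h : p a ↔ ∃ x, x ∈ c.eval (Encodable.encode a) := by
    rw [hc]; simp [Encodable.encodek, Part.mem_assert_iff]
  rw [h]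
  simp only [Nat.Partrec.Code.evaln_complete, ceSet, Set.mem_ofPred_eq, Option.isSome_iff_exists,
    Option.mem_def]
  exact exists_comm

theorem PrimrecRel.rePred_exists {Q : α → ℕ → Prop} (hQ : PrimrecRel Q) :
    REPred fun a => ∃ k, Q a k := by
  obtain ⟨hd, hQ'⟩ := hQ
  have h1 : Computable₂ fun a k => @decide (Q a k) (hd (a, k)) := hQ'.to_comp
  have h2 : Partrec fun a => Nat.rfind fun k => Part.some (@decide (Q a k) (hd (a, k))) :=
    Partrec.rfind h1.partrec₂
  refine h2.dom_re.of_eq fun a => ?_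
  refine (Nat.rfind_dom (p := fun k => Part.some (@decide (Q a k) (hd (a, k))))).trans ?_
  simp

theorem primrecRel_evaln_isSome : PrimrecRel fun (q : Nat.Partrec.Code × α) k =>
    (q.1.evaln k (Encodable.encode q.2)).isSome :=
  Primrec.eq.comp (Primrec.option_isSome.comp (Nat.Partrec.Code.primrec_evaln.comp
    (Primrec.pair (Primrec.pair Primrec.snd (Primrec.fst.comp Primrec.fst))
      (Primrec.encode.comp (Primrec.snd.comp Primrec.fst))))) (Primrec.const true)

theorem rePred_mem_ceSet : REPred fun q : Nat.Partrec.Code × α => q.2 ∈ ceSet α q.1 :=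
  primrecRel_evaln_isSome.rePred_exists

theorem rePred_iff {p : α → Prop} :
    REPred p ↔ ∃ Q : α → ℕ → Prop, PrimrecRel Q ∧ ∀ a, p a ↔ ∃ k, Q a k := by
  constructor
  · intro hp
    obtain ⟨c, hc⟩ := hp.exists_code
    refine ⟨fun a k => (c.evaln k (Encodable.encode a)).isSome, ?_, hc⟩
    exact primrecRel_evaln_isSome.comp (Primrec.pair (Primrec.const c) Primrec.fst) Primrec.snd
  · rintro ⟨Q, hQ, h⟩
    exact hQ.rePred_exists.of_eq fun a => (h a).symm

theorem PrimrecPred.rePred {p : α → Prop} (hp : PrimrecPred p) : REPred p :=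
  rePred_iff.2 ⟨fun a _ => p a, hp.comp Primrec.fst, fun a => by simp⟩

theorem REPred.comp {p : β → Prop} (hp : REPred p) {f : α → β} (hf : Primrec f) :
    REPred fun a => p (f a) := by
  obtain ⟨Q, hQ, h⟩ := rePred_iff.1 hp
  exact rePred_iff.2 ⟨fun a k => Q (f a) k, PrimrecRel.comp hQ (hf.comp Primrec.fst) Primrec.snd,
    fun a => h _⟩

theorem REPred.and {p q : α → Prop} (hp : REPred p) (hq : REPred q) :
    REPred fun a => p a ∧ q a := by
  obtain ⟨P, hP, h⟩ := rePred_iff.1 hp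
  obtain ⟨Q, hQ, h'⟩ := rePred_iff.1 hq
  refine rePred_iff.2 ⟨fun a k => P a k.unpair.1 ∧ Q a k.unpair.2, ?_, fun a => ?_⟩
  · have hu : Primrec fun q : α × ℕ => q.2.unpair := Primrec.unpair.comp Primrec.snd
    exact (PrimrecRel.comp hP Primrec.fst (Primrec.fst.comp hu)).and
      (PrimrecRel.comp hQ Primrec.fst (Primrec.snd.comp hu))
  · rw [h, h']
    constructor
    · rintro ⟨⟨k, hk⟩, l, hl⟩
      exact ⟨Nat.pair k l, by simpa using ⟨hk, hl⟩⟩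
    · rintro ⟨k, hk, hl⟩
      exact ⟨⟨_, hk⟩, _, hl⟩

theorem REPred.exists {p : α → β → Prop} (hp : REPred fun q : α × β => p q.1 q.2) :
    REPred fun a => ∃ b, p a b := by
  obtain ⟨Q, hQ, h⟩ := rePred_iff.1 hp
  refine rePred_iff.2 ⟨fun a k => ∃ b ∈ (Encodable.decode (α := β) k.unpair.1).toList,
    Q (a, b) k.unpair.2, ?_, fun a => ?_⟩
  · have hu : Primrec fun q : α × ℕ => q.2.unpair := Primrec.unpair.comp Primrec.snd
    exact PrimrecPred.bex_list
      (Primrec.optionToList.comp (Primrec.decode.comp (Primrec.fst.comp hu)))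
      (PrimrecRel.comp hQ (Primrec.pair (Primrec.fst.comp Primrec.fst) Primrec.snd)
        (Primrec.snd.comp (hu.comp Primrec.fst)))
  · constructor
    · rintro ⟨b, hb⟩
      obtain ⟨k, hk⟩ := (h (a, b)).1 hb
      exact ⟨Nat.pair (Encodable.encode b) k, b, by simp, by simpa using hk⟩
    · rintro ⟨k, b, -, hb⟩
      exact ⟨b, (h (a, b)).2 ⟨_, hb⟩⟩

theorem REPred.ball_list {L : α → List β} {p : α → β → Prop} (hL : Primrec L)
    (hp : REPred fun q : α × β => p q.1 q.2) : REPred fun a => ∀ b ∈ L a, p a b := by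
  obtain ⟨Q, hQ, h⟩ := rePred_iff.1 hp
  refine rePred_iff.2 ⟨fun a k => ∀ b ∈ L a, ∃ l < k, Q (a, b) l, ?_, fun a => ?_⟩
  · refine PrimrecPred.ball_list (hL.comp Primrec.fst)
      (PrimrecPred.bex_lt (Primrec.snd.comp Primrec.fst) ?_)
    exact PrimrecRel.comp hQ (Primrec.pair (Primrec.fst.comp (Primrec.fst.comp Primrec.fst))
      (Primrec.snd.comp Primrec.fst)) Primrec.snd
  · constructor
    · intro H
      have H' : ∀ b ∈ L a, ∃ k, Q (a, b) k := fun b hb => (h (a, b)).1 (H b hb)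
      change ∃ k, ∀ b ∈ L a, ∃ l < k, Q (a, b) l
      clear H
      generalize L a = l at H' ⊢
      induction l with
      | nil => exact ⟨0, by simp⟩
      | cons b l ih =>
        obtain ⟨k, hk⟩ := ih fun b hb => H' b (List.mem_cons_of_mem _ hb)
        obtain ⟨k', hk'⟩ := H' b List.mem_cons_self
        refine ⟨max k (k' + 1), fun c hc => ?_⟩
        rcases List.mem_cons.1 hc with rfl | hc
        · exact ⟨k', by omega, hk'⟩
        · obtain ⟨l, hl, hq⟩ := hk c hc
          exact ⟨l, by omega, hq⟩
    · rintro ⟨k, hk⟩ b hb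
      obtain ⟨l, -, hl⟩ := hk b hb
      exact (h (a, b)).2 ⟨l, hl⟩

end Toolkit

theorem CE.exists_code {α : Type*} [Primcodable α] {A : Set α} (hA : CE A) :
    ∃ c, A = ceSet α c := by
  obtain ⟨c, hc⟩ := REPred.exists_code hA
  exact ⟨c, Set.ext hc⟩

/-! ### The stage construction -/

/-- The priority level of a coded requirement. -/
def lev (j : ℕ) : ℕ := j.unpair.1

/-- In a construction that treats requirement `f s` at stage `s`, the number `n` survives the stages
below `m`: no later stage `s < m` has a level at most that of `n`. -/
def Surv (f : ℕ → ℕ) (n m : ℕ) : Prop :=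
  ∀ s < m, n < s → lev (f n) < lev (f s)

/-- What the first `r` stages tell about the point attached to `C`: the subbasic neighbourhood coded
by `d` is enumerated. A number still alive at stage `r` is sent to `∞` or `∞⋆` according to `C`;
a number killed at stage `m` is sent to `m`. -/
def Seen (f : ℕ → ℕ) (r : ℕ) (C : Set ℕ) (d : ℕ) : Prop :=
  d < r ∧ Surv f d.unpair.1 d.unpair.2.unpair.2 ∧
    (d.unpair.2.unpair.1 = 0 ∧ ¬ Surv f d.unpair.1 (d.unpair.2.unpair.2 + 1) ∨
     d.unpair.2.unpair.1 = 1 ∧ (d.unpair.1 ∈ C ∨ ¬ Surv f d.unpair.1 r) ∨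
     d.unpair.2.unpair.1 = 2 ∧ (d.unpair.1 ∉ C ∨ ¬ Surv f d.unpair.1 r))

/-- The numbers below `r` of level below `e` that are alive at stage `r`. -/
noncomputable def low (f : ℕ → ℕ) (r e : ℕ) : List ℕ :=
  open Classical in (List.range r).filter fun n => Surv f n r ∧ lev (f n) < e

/-- Every member of `σ` is enumerated by `Φ` from neighbourhoods seen by stage `r`. -/
def Derives (f : ℕ → ℕ) (r : ℕ) (Φ : Set (ℕ × List ℕ)) (C : Set ℕ) (σ : List ℕ) : Prop :=
  ∀ k ∈ σ, ∃ D : List ℕ, (k, D) ∈ Φ ∧ ∀ d ∈ D, Seen f r C d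

/-- The enumeration operator attached to level `e`. -/
def reqOp (e : ℕ) : Set (ℕ × List ℕ) :=
  ceSet _ (Denumerable.ofNat Nat.Partrec.Code e.unpair.2.unpair.1)

/-- The set of pairs of basic open sets attached to level `e`. -/
def reqSep (e : ℕ) : Set (List ℕ × List ℕ) :=
  ceSet _ (Denumerable.ofNat Nat.Partrec.Code e.unpair.2.unpair.2)

/-- The requirement of level `e` that looks for a splitting above the assignment which sends the
members of `τ` to `∞` and the other members of `F` to `∞⋆`. The successor keeps these codes apart
from those of idle stages. -/
def reqCode (e : ℕ) (F τ : List ℕ) : ℕ :=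
  Nat.pair e (Encodable.encode (F, τ) + 1)

/-- By stage `r` a splitting for the requirement `j` has appeared: two points that agree on the
numbers of higher priority, and from which the operator enumerates basic open sets declared
disjoint. -/
def Splits (f : ℕ → ℕ) (r j : ℕ) : Prop :=
  ∃ q : (List ℕ × List ℕ) × (List ℕ × List ℕ),
    j = reqCode (lev j) (low f r (lev j)) ((low f r (lev j)).filter (· ∈ q.1.1)) ∧
    j = reqCode (lev j) (low f r (lev j)) ((low f r (lev j)).filter (· ∈ q.1.2)) ∧
    q.2 ∈ reqSep (lev j) ∧
    Derives f r (reqOp (lev j)) {k | k ∈ q.1.1} q.2.1 ∧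
    Derives f r (reqOp (lev j)) {k | k ∈ q.1.2} q.2.2

section Congr

variable {f g : ℕ → ℕ} {r : ℕ}

theorem Surv.congr (h : ∀ s < r, f s = g s) {n m : ℕ} (hm : m ≤ r) : Surv f n m ↔ Surv g n m := by
  unfold Surv
  refine forall_congr' fun s => forall_congr' fun hs => forall_congr' fun hn => ?_
  rw [h s (by omega), h n (by omega)]

theorem Seen.congr (h : ∀ s < r, f s = g s) {C : Set ℕ} {d : ℕ} : Seen f r C d ↔ Seen g r C d := by
  unfold Seen
  refine and_congr_right fun hd => ?_
  have h1 : d.unpair.2.unpair.2 ≤ d := (Nat.unpair_right_le _).trans (Nat.unpair_right_le _)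
  rw [Surv.congr h (by omega : d.unpair.2.unpair.2 ≤ r),
    Surv.congr h (by omega : d.unpair.2.unpair.2 + 1 ≤ r), Surv.congr h le_rfl]

theorem low_congr (h : ∀ s < r, f s = g s) (e : ℕ) : low f r e = low g r e := by
  unfold low
  refine List.filter_congr fun n hn => ?_
  rw [h n (List.mem_range.1 hn), Surv.congr h le_rfl]

theorem Derives.congr (h : ∀ s < r, f s = g s) {Φ : Set (ℕ × List ℕ)} {C : Set ℕ} {σ : List ℕ} :
    Derives f r Φ C σ ↔ Derives g r Φ C σ := by
  unfold Derives
  simp only [Seen.congr h]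

theorem Splits.congr (h : ∀ s < r, f s = g s) {j : ℕ} : Splits f r j ↔ Splits g r j := by
  unfold Splits
  simp only [low_congr h, Derives.congr h]

end Congr

/-! ### Effectivity of the stage construction -/

/-- The finite sequence `h`, continued by zeros. -/
def lookup (h : List ℕ) (s : ℕ) : ℕ := h.getD s 0

theorem lookup_map_range (f : ℕ → ℕ) {r s : ℕ} (hs : s < r) :
    lookup ((List.range r).map f) s = f s := by
  simp [lookup, List.getD, hs]

theorem primrec_lev : Primrec lev := Primrec.fst.comp Primrec.unpair

theorem primrec_lookup : Primrec₂ lookup := Primrec.list_getD 0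

section Effective

variable {α : Type*} [Primcodable α] {h C σ : α → List ℕ} {n m r d : α → ℕ}

theorem primrecPred_surv (hh : Primrec h) (hn : Primrec n) (hm : Primrec m) :
    PrimrecPred fun a => Surv (lookup (h a)) (n a) (m a) := by
  refine PrimrecPred.ball_lt hm (PrimrecPred.imp
    (Primrec.nat_lt.comp (hn.comp Primrec.fst) Primrec.snd) (Primrec.nat_lt.comp ?_ ?_))
  · exact primrec_lev.comp (primrec_lookup.comp (hh.comp Primrec.fst) (hn.comp Primrec.fst))
  · exact primrec_lev.comp (primrec_lookup.comp (hh.comp Primrec.fst) Primrec.snd)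

theorem primrecPred_seen (hh : Primrec h) (hr : Primrec r) (hC : Primrec C) (hd : Primrec d) :
    PrimrecPred fun a => Seen (lookup (h a)) (r a) {k | k ∈ C a} (d a) := by
  have h1 : Primrec fun a => (d a).unpair.1 := Primrec.fst.comp (Primrec.unpair.comp hd)
  have h2 : Primrec fun a => (d a).unpair.2.unpair :=
    Primrec.unpair.comp (Primrec.snd.comp (Primrec.unpair.comp hd))
  have h3 := Primrec.fst.comp h2
  have h4 := Primrec.snd.comp h2
  have hmem : PrimrecPred fun a => (d a).unpair.1 ∈ {k | k ∈ C a} := PrimrecPred.mem_list h1 hC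
  have hs := (primrecPred_surv hh h1 hr).not
  refine (Primrec.nat_lt.comp hd hr).and ((primrecPred_surv hh h1 h4).and (.or ?_ (.or ?_ ?_)))
  · exact (Primrec.eq.comp h3 (Primrec.const 0)).and
      (primrecPred_surv hh h1 (Primrec.succ.comp h4)).not
  · exact (Primrec.eq.comp h3 (Primrec.const 1)).and (hmem.or hs)
  · exact (Primrec.eq.comp h3 (Primrec.const 2)).and (hmem.not.or hs)

theorem primrec_low (hh : Primrec h) (hn : Primrec n) :
    Primrec fun a => low (lookup (h a)) (h a).length (n a) := by
  classical
  have hR : PrimrecRel fun (k : ℕ) (q : List ℕ × ℕ) =>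
      Surv (lookup q.1) k q.1.length ∧ lev (lookup q.1 k) < q.2 :=
    (primrecPred_surv (Primrec.fst.comp Primrec.snd) Primrec.fst
      (Primrec.list_length.comp (Primrec.fst.comp Primrec.snd))).and
      (Primrec.nat_lt.comp (primrec_lev.comp (primrec_lookup.comp
        (Primrec.fst.comp Primrec.snd) Primrec.fst)) (Primrec.snd.comp Primrec.snd))
  refine (hR.listFilter.comp (Primrec.list_range.comp (Primrec.list_length.comp hh))
    (Primrec.pair hh hn)).of_eq fun a => ?_
  unfold low
  exact List.filter_congr fun _ _ => by simp

theorem primrec_filter_mem (hσ : Primrec σ) (hC : Primrec C) :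
    Primrec fun a => (σ a).filter (· ∈ C a) :=
  (PrimrecRel.listFilter (R := fun (k : ℕ) (c : List ℕ) => k ∈ c)
    (PrimrecPred.mem_list Primrec.fst Primrec.snd)).comp hσ hC

theorem rePred_derives (hh : Primrec h) {c : α → Nat.Partrec.Code} (hc : Primrec c)
    (hC : Primrec C) (hσ : Primrec σ) : REPred fun a =>
      Derives (lookup (h a)) (h a).length (ceSet _ (c a)) {k | k ∈ C a} (σ a) := by
  refine REPred.ball_list hσ (REPred.exists (REPred.and ?_ ?_))
  · exact rePred_mem_ceSet.comp (Primrec.pair (hc.comp (Primrec.fst.comp Primrec.fst))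
      (Primrec.pair (Primrec.snd.comp Primrec.fst) Primrec.snd))
  · refine (PrimrecPred.ball_list Primrec.snd ?_).rePred
    have hp : Primrec fun q : ((α × ℕ) × List ℕ) × ℕ => q.1.1.1 :=
      Primrec.fst.comp (Primrec.fst.comp Primrec.fst)
    exact primrecPred_seen (hh.comp hp) (Primrec.list_length.comp (hh.comp hp)) (hC.comp hp)
      Primrec.snd

end Effective

theorem rePred_splits : REPred fun q : List ℕ × ℕ => Splits (lookup q.1) q.1.length q.2 := by
  refine REPred.exists ?_
  have hh : Primrec fun q : (List ℕ × ℕ) × ((List ℕ × List ℕ) × (List ℕ × List ℕ)) => q.1.1 :=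
    Primrec.fst.comp Primrec.fst
  have hj : Primrec fun q : (List ℕ × ℕ) × ((List ℕ × List ℕ) × (List ℕ × List ℕ)) => q.1.2 :=
    Primrec.snd.comp Primrec.fst
  have h1 : Primrec fun q : (List ℕ × ℕ) × ((List ℕ × List ℕ) × (List ℕ × List ℕ)) => q.2.1 :=
    Primrec.fst.comp Primrec.snd
  have h2 : Primrec fun q : (List ℕ × ℕ) × ((List ℕ × List ℕ) × (List ℕ × List ℕ)) => q.2.2 :=
    Primrec.snd.comp Primrec.snd
  have he := primrec_lev.comp hj
  have hl := primrec_low hh he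
  have hcode : ∀ {τ : (List ℕ × ℕ) × ((List ℕ × List ℕ) × (List ℕ × List ℕ)) → List ℕ},
      Primrec τ → PrimrecPred fun q => q.1.2 = reqCode (lev q.1.2)
        (low (lookup q.1.1) q.1.1.length (lev q.1.2)) (τ q) := fun hτ =>
    Primrec.eq.comp hj (Primrec₂.natPair.comp he
      (Primrec.succ.comp (Primrec.encode.comp (Primrec.pair hl hτ))))
  have hu : Primrec fun q : (List ℕ × ℕ) × ((List ℕ × List ℕ) × (List ℕ × List ℕ)) =>
      (lev q.1.2).unpair.2.unpair :=
    Primrec.unpair.comp (Primrec.snd.comp (Primrec.unpair.comp he))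
  have hc1 := (Primrec.ofNat Nat.Partrec.Code).comp (Primrec.fst.comp hu)
  have hc2 := (Primrec.ofNat Nat.Partrec.Code).comp (Primrec.snd.comp hu)
  refine (hcode (primrec_filter_mem hl (Primrec.fst.comp h1))).rePred.and
    ((hcode (primrec_filter_mem hl (Primrec.snd.comp h1))).rePred.and
    (REPred.and ?_ (REPred.and ?_ ?_)))
  · exact rePred_mem_ceSet.comp (Primrec.pair hc2 h2)
  · exact rePred_derives hh hc1 (Primrec.fst.comp h1) (Primrec.fst.comp h2)
  · exact rePred_derives hh hc1 (Primrec.snd.comp h1) (Primrec.snd.comp h2)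

/-- The priority construction in the form used below: `f` treats every requirement at most once,
only after it has split, and it does treat every requirement that keeps splitting. -/
theorem exists_stages : ∃ f : ℕ → ℕ, Primrec f ∧
    (∀ t, f t = Nat.pair t 0 ∨ (∀ s < t, f s ≠ f t) ∧ ∃ r ≤ t, Splits f r (f t)) ∧
    ∀ r j, Splits f r j → ∃ t, f t = j := by
  obtain ⟨Q, hQ, hspl⟩ := rePred_iff.1 rePred_splits
  classical
  -- stage `t = ⟨j, r, w⟩` looks at the first `r` stages and checks the witness `w` for `j`
  let c : List ℕ → Prop := fun h => h.length.unpair.1 ∉ h ∧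
    Q (h.take h.length.unpair.2.unpair.1, h.length.unpair.1) h.length.unpair.2.unpair.2
  let step : List ℕ → ℕ := fun h => if c h then h.length.unpair.1 else Nat.pair h.length 0
  have hpos : ∀ h, c h → step h = h.length.unpair.1 := fun h hc => if_pos hc
  have hneg : ∀ h, ¬ c h → step h = Nat.pair h.length 0 := fun h hc => if_neg hc
  have hstep : Primrec step := by
    have h0 : Primrec fun h : List ℕ => h.length := Primrec.list_length
    have h1 := Primrec.fst.comp (Primrec.unpair.comp h0)
    have h2 := Primrec.unpair.comp (Primrec.snd.comp (Primrec.unpair.comp h0))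
    refine Primrec.ite ?_ h1 (Primrec₂.natPair.comp h0 (Primrec.const 0))
    refine (PrimrecPred.mem_list h1 Primrec.id).not.and (PrimrecRel.comp hQ (Primrec.pair ?_ h1) ?_)
    · exact Primrec.list_take.comp (Primrec.fst.comp h2) Primrec.id
    · exact Primrec.snd.comp h2
  let hist : ℕ → List ℕ := fun n => Nat.rec [] (fun _ h => h ++ [step h]) n
  have hhist : Primrec hist := Primrec.nat_rec₁ _ (Primrec.list_append.comp Primrec.snd
    (Primrec.list_cons.comp (hstep.comp Primrec.snd) (Primrec.const []))).to₂
  let f : ℕ → ℕ := fun n => step (hist n)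
  have hf : ∀ n, hist n = (List.range n).map f := by
    intro n
    induction n with
    | zero => rfl
    | succ n ih => rw [List.range_succ, List.map_append, ← ih]; rfl
  have hlen : ∀ n, (hist n).length = n := fun n => by simp [hf]
  have htake : ∀ {r t}, r ≤ t → (hist t).take r = hist r := by
    intro r t hrt
    rw [hf, hf, ← List.map_take, List.take_range, min_eq_left hrt]
  have hS : ∀ r j, Splits f r j ↔ ∃ w, Q (hist r, j) w := by
    intro r j
    rw [← hspl, hlen]
    refine Splits.congr fun s hs => ?_
    rw [hf, lookup_map_range f hs]
  have hmem : ∀ t j, j ∈ hist t ↔ ∃ s < t, f s = j := fun t j => by simp [hf]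
  refine ⟨f, hstep.comp hhist, fun t => ?_, fun r j h => ?_⟩
  · rcases em (c (hist t)) with hc | hc
    · have hft : f t = (hist t).length.unpair.1 := hpos _ hc
      rw [hlen] at hft
      obtain ⟨h1, h2⟩ := hc
      rw [hlen] at h1 h2
      have hr : t.unpair.2.unpair.1 ≤ t := (Nat.unpair_left_le _).trans (Nat.unpair_right_le _)
      rw [htake hr, ← hft] at h2
      refine Or.inr ⟨fun s hs he => h1 ?_, _, hr, (hS _ _).2 ⟨_, h2⟩⟩
      rw [← hft]
      exact (hmem _ _).2 ⟨s, hs, he⟩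
    · have hft : f t = Nat.pair (hist t).length 0 := hneg _ hc
      rw [hlen] at hft
      exact Or.inl hft
  · obtain ⟨w, hw⟩ := (hS r j).1 h
    by_contra hne
    push Not at hne
    apply hne (Nat.pair j (Nat.pair r w))
    have hr : r ≤ Nat.pair j (Nat.pair r w) :=
      (Nat.left_le_pair _ _).trans (Nat.right_le_pair _ _)
    have hc : c (hist (Nat.pair j (Nat.pair r w))) := by
      refine ⟨?_, ?_⟩
      · rw [hlen, hmem]
        rintro ⟨s, -, hs⟩
        exact hne s (by simpa using hs)
      · rw [hlen]
        simp only [Nat.unpair_pair]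
        rw [htake hr]
        exact hw
    exact (hpos _ hc).trans (by rw [hlen, Nat.unpair_pair])

/-! ### The surviving numbers -/

theorem Surv.anti {f : ℕ → ℕ} {n m m' : ℕ} (h : m ≤ m') (hs : Surv f n m') : Surv f n m :=
  fun s hsm => hs s (by omega)

theorem surv_zero (f : ℕ → ℕ) (n : ℕ) : Surv f n 0 := fun s hs => absurd hs (by omega)

theorem filter_range_eq {p : ℕ → Prop} [DecidablePred p] {N r : ℕ} (hp : ∀ n, p n → n < N)
    (hr : N ≤ r) : (List.range r).filter (fun n => p n) = (List.range N).filter fun n => p n := by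
  obtain ⟨k, rfl⟩ := Nat.exists_eq_add_of_le hr
  rw [List.range_add, List.filter_append]
  have : ((List.range k).map (N + ·)).filter (fun n => decide (p n)) = [] := by
    rw [List.filter_eq_nil_iff]
    intro a ha hpa
    obtain ⟨b, -, rfl⟩ := List.mem_map.1 ha
    have := hp _ (by simpa using hpa)
    omega
  rw [this, List.append_nil]

theorem filter_range_sublist {p : ℕ → Prop} [DecidablePred p] {N r : ℕ} (hp : ∀ n, p n → n < N) :
    ((List.range r).filter fun n => p n).Sublist (List.range N) := by
  rcases le_total N r with h | h
  · rw [filter_range_eq hp h]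
    exact List.filter_sublist
  · exact List.filter_sublist.trans (List.range_sublist.2 h)

theorem finite_sublists (l : List ℕ) : {F : List ℕ | F.Sublist l}.Finite := by
  refine (l.sublists.finite_toSet).subset fun F hF => ?_
  exact List.mem_sublists.2 hF

theorem lev_reqCode (e : ℕ) (F τ : List ℕ) : lev (reqCode e F τ) = e := by
  simp [lev, reqCode]

theorem reqCode_inj {e e' : ℕ} {F τ F' τ' : List ℕ} :
    reqCode e F τ = reqCode e' F' τ' ↔ e = e' ∧ F = F' ∧ τ = τ' := by
  simp [reqCode, Nat.pair_eq_pair]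

section Stages

variable {f : ℕ → ℕ}
  (hact : ∀ t, f t = Nat.pair t 0 ∨ (∀ s < t, f s ≠ f t) ∧ ∃ r ≤ t, Splits f r (f t))

include hact

/-- A requirement of level `e` is determined by its assignment, which only concerns numbers of
lower level; as requirements are not repeated, the claim follows by induction on the level. -/
theorem finite_lev (e : ℕ) : {t | lev (f t) = e}.Finite := by
  induction e using Nat.strong_induction_on with
  | _ e ih =>
    have hlow : {t | lev (f t) < e}.Finite := by
      have := (Set.finite_lt_nat e).biUnion (t := fun e' => {t | lev (f t) = e'}) ih
      refine this.subset fun t ht => ?_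
      simp only [Set.mem_iUnion]
      exact ⟨lev (f t), ht, rfl⟩
    obtain ⟨N, hN⟩ := hlow.bddAbove
    let K : Set ℕ := (fun q : List ℕ × List ℕ => reqCode e q.1 q.2) ''
      ({F | F.Sublist (List.range (N + 1))} ×ˢ {F | F.Sublist (List.range (N + 1))})
    have hK : K.Finite := ((finite_sublists _).prod (finite_sublists _)).image _
    have hfin : {t | (∀ s < t, f s ≠ f t) ∧ f t ∈ K}.Finite := by
      refine Set.Finite.of_finite_image (f := f) (hK.subset ?_) ?_
      · rintro _ ⟨t, ht, rfl⟩
        exact ht.2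
      · intro s hs t ht hst
        rcases lt_trichotomy s t with h | h | h
        · exact absurd hst (ht.1 s h)
        · exact h
        · exact absurd hst.symm (hs.1 t h)
    refine (hfin.union (Set.finite_singleton e)).subset fun t ht => ?_
    rcases hact t with h | ⟨h, r, -, q, hq, -⟩
    · right
      have ht' : lev (f t) = e := ht
      rw [h] at ht'
      simpa [lev] using ht'
    · refine Or.inl ⟨h, ?_⟩
      have ht' : lev (f t) = e := ht
      rw [ht'] at hq
      have hF : (low f r e).Sublist (List.range (N + 1)) := by
        classical
        unfold low
        exact filter_range_sublist fun n hn => Nat.lt_succ_of_le (hN hn.2)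
      exact ⟨(_, _), ⟨hF, List.filter_sublist.trans hF⟩, hq.symm⟩

theorem exists_lev_lt_bound (e : ℕ) : ∃ N, ∀ t, lev (f t) < e → t < N := by
  have : {t | lev (f t) < e}.Finite := by
    refine ((Set.finite_lt_nat e).biUnion (t := fun e' => {t | lev (f t) = e'})
      fun e' _ => finite_lev hact e').subset fun t ht => ?_
    simp only [Set.mem_iUnion]
    exact ⟨lev (f t), ht, rfl⟩
  obtain ⟨N, hN⟩ := this.bddAbove
  exact ⟨N + 1, fun t ht => Nat.lt_succ_of_le (hN ht)⟩

theorem exists_surv_ge (N : ℕ) : ∃ n ≥ N, ∀ m, Surv f n m := by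
  classical
  have hex : ∃ e, ∃ t ≥ N, lev (f t) = e := ⟨_, N, le_rfl, rfl⟩
  obtain ⟨t, ht, hte⟩ := Nat.find_spec hex
  have hfin : {t | N ≤ t ∧ lev (f t) = Nat.find hex}.Finite :=
    (finite_lev hact _).subset fun t ht => ht.2
  obtain ⟨n, ⟨hn, hne⟩, hmax⟩ := hfin.exists_maximal ⟨t, ht, hte⟩
  refine ⟨n, hn, fun m s _ hs => ?_⟩
  have h1 : Nat.find hex ≤ lev (f s) := Nat.find_min' hex ⟨s, by omega, rfl⟩
  rcases h1.eq_or_lt with h | h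
  · have := hmax (y := s) ⟨by omega, h.symm⟩ (by omega)
    omega
  · omega

theorem exists_low_eq (e : ℕ) : ∃ F : List ℕ, ∃ r₀, ∀ r ≥ r₀, low f r e = F := by
  classical
  obtain ⟨N, hN⟩ := exists_lev_lt_bound hact e
  have hev : ∀ᶠ r in Filter.atTop, ∀ n ∈ {n | n < N}, (Surv f n r ↔ ∀ m, Surv f n m) := by
    rw [Filter.eventually_all_finite (Set.finite_lt_nat N)]
    intro n _
    by_cases h : ∀ m, Surv f n m
    · exact Filter.Eventually.of_forall fun r => ⟨fun _ => h, fun _ => h r⟩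
    · push Not at h
      obtain ⟨m, hm⟩ := h
      filter_upwards [Filter.eventually_ge_atTop m] with r hr
      exact ⟨fun h => absurd (h.anti hr) hm, fun h => h r⟩
  obtain ⟨r₁, hr₁⟩ := Filter.eventually_atTop.1 hev
  refine ⟨(List.range N).filter fun n => (∀ m, Surv f n m) ∧ lev (f n) < e, max N r₁,
    fun r hr => ?_⟩
  unfold low
  rw [filter_range_eq (fun n hn => hN n hn.2) (le_of_max_le_left hr)]
  refine List.filter_congr fun n hn => ?_
  rw [hr₁ r (le_of_max_le_right hr) n (List.mem_range.1 hn)]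

end Stages

/-! ### The points of the telophase power attached to the stages -/

/-- The point attached to `C`: a number that is killed at stage `m` is sent to `m`, and the
surviving numbers are sent to `∞` or `∞⋆` according to whether they belong to `C`. -/
noncomputable def point (f : ℕ → ℕ) (C : Set ℕ) (n : ℕ) : Telophase :=
  open Classical in
  if h : ∃ m, ¬ Surv f n m then .fin (Nat.find h - 1) else if n ∈ C then .inf else .infStar

/-- The neighbourhood filter of the point attached to `C`. -/
abbrev pointBase (f : ℕ → ℕ) (C : Set ℕ) : Set ℕ :=
  Nbase telophasePowerBase (point f C)

section Points

variable {f : ℕ → ℕ}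

theorem Seen.mono {r r' : ℕ} {C : Set ℕ} {d : ℕ} (h : r ≤ r') (hs : Seen f r C d) :
    Seen f r' C d := by
  have hk : ¬ Surv f d.unpair.1 r → ¬ Surv f d.unpair.1 r' := fun h1 h2 => h1 (h2.anti h)
  obtain ⟨h1, h2, h3⟩ := hs
  exact ⟨by omega, h2, h3.imp_right fun h3 => h3.imp (And.imp_right (Or.imp_right hk))
    (And.imp_right (Or.imp_right hk))⟩

theorem Seen.congr_set {r : ℕ} {C C' : Set ℕ} (h : ∀ n < r, n ∈ C ↔ n ∈ C') {d : ℕ} :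
    Seen f r C d ↔ Seen f r C' d := by
  unfold Seen
  refine and_congr_right fun hd => ?_
  rw [h d.unpair.1 ((Nat.unpair_left_le d).trans_lt hd)]

theorem mem_pointBase {C : Set ℕ} {d : ℕ} : d ∈ pointBase f C ↔ ∃ r, Seen f r C d := by
  classical
  unfold pointBase Nbase telophasePowerBase Seen
  simp only [Set.mem_ofPred_eq]
  generalize hn : d.unpair.1 = n
  generalize hi : d.unpair.2.unpair.1 = i
  generalize hm : d.unpair.2.unpair.2 = m
  by_cases h : ∃ k, ¬ Surv f n k
  · have hx : point f C n = .fin (Nat.find h - 1) := by rw [point, dif_pos h]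
    have hS : ∀ k, Surv f n k ↔ k < Nat.find h := fun k =>
      ⟨fun hk => not_le.1 fun hle => Nat.find_spec h (hk.anti hle), fun hk => by
        simpa using Nat.find_min h hk⟩
    have hpos : 0 < Nat.find h := (hS 0).1 (surv_zero f n)
    rw [hx]
    generalize Nat.find h = v at hS hpos
    simp only [hS]
    rcases i with _ | _ | _ | i
    · simp only [Telophase.sub, Set.mem_singleton_iff, Telophase.fin.injEq]
      constructor
      · rintro rfl
        exact ⟨d + 1, by omega, by omega, Or.inl ⟨trivial, by omega⟩⟩
      · rintro ⟨r, -, h1, ⟨-, h2⟩ | ⟨h2, -⟩ | ⟨h2, -⟩⟩ <;> omega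
    · simp only [Telophase.sub, Set.mem_ofPred_eq, reduceCtorEq, false_or, Telophase.fin.injEq]
      constructor
      · rintro ⟨k, hk, rfl⟩
        exact ⟨d + v + 1, by omega, by omega, Or.inr (Or.inl ⟨trivial, Or.inr (by omega)⟩)⟩
      · rintro ⟨r, -, h1, -⟩
        exact ⟨_, by omega, rfl⟩
    · simp only [Telophase.sub, Set.mem_ofPred_eq, reduceCtorEq, false_or, Telophase.fin.injEq]
      constructor
      · rintro ⟨k, hk, rfl⟩
        exact ⟨d + v + 1, by omega, by omega, Or.inr (Or.inr ⟨trivial, Or.inr (by omega)⟩)⟩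
      · rintro ⟨r, -, h1, -⟩
        exact ⟨_, by omega, rfl⟩
    · simp only [Telophase.sub, Set.mem_empty_iff_false, false_iff]
      rintro ⟨r, -, -, ⟨h2, -⟩ | ⟨h2, -⟩ | ⟨h2, -⟩⟩ <;> omega
  · have hx : point f C n = if n ∈ C then .inf else .infStar := by rw [point, dif_neg h]
    push Not at h
    have hS : ∀ k, Surv f n k ↔ True := fun k => iff_true_intro (h k)
    rw [hx]
    simp only [hS, true_and, not_true_eq_false, or_false, and_false, false_or]
    have hd : ∀ p : Prop, p ↔ ∃ r, d < r ∧ p := fun p =>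
      ⟨fun hp => ⟨d + 1, by omega, hp⟩, fun ⟨_, _, hp⟩ => hp⟩
    rw [← hd]
    rcases i with _ | _ | _ | i <;> by_cases hc : n ∈ C <;> simp [Telophase.sub, hc]

theorem forall_mem_pointBase {C : Set ℕ} {D : List ℕ} :
    (∀ d ∈ D, d ∈ pointBase f C) ↔ ∃ r, ∀ d ∈ D, Seen f r C d := by
  constructor
  · intro h
    induction D with
    | nil => exact ⟨0, by simp⟩
    | cons d D ih =>
      obtain ⟨r, hr⟩ := ih fun d hd => h d (List.mem_cons_of_mem _ hd)
      obtain ⟨r', hr'⟩ := mem_pointBase.1 (h d List.mem_cons_self)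
      refine ⟨max r r', fun c hc => ?_⟩
      rcases List.mem_cons.1 hc with rfl | hc
      · exact hr'.mono (le_max_right _ _)
      · exact (hr c hc).mono (le_max_left _ _)
  · rintro ⟨r, hr⟩ d hd
    exact mem_pointBase.2 ⟨r, hr d hd⟩

theorem Derives.mono {r r' : ℕ} {Φ : Set (ℕ × List ℕ)} {C : Set ℕ} {σ : List ℕ} (h : r ≤ r')
    (hs : Derives f r Φ C σ) : Derives f r' Φ C σ := fun k hk =>
  let ⟨D, hD, hd⟩ := hs k hk
  ⟨D, hD, fun d hdD => (hd d hdD).mono h⟩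

theorem exists_derives {Φ : Set (ℕ × List ℕ)} {C : Set ℕ} {σ : List ℕ}
    (h : ∀ k ∈ σ, k ∈ enumOp Φ (pointBase f C)) : ∃ r, Derives f r Φ C σ := by
  induction σ with
  | nil => exact ⟨0, fun k hk => by simp at hk⟩
  | cons k σ ih =>
    obtain ⟨r, hr⟩ := ih fun d hd => h d (List.mem_cons_of_mem _ hd)
    obtain ⟨D, hD, hd⟩ := h k List.mem_cons_self
    obtain ⟨r', hr'⟩ := forall_mem_pointBase.1 hd
    refine ⟨max r r', fun c hc => ?_⟩
    rcases List.mem_cons.1 hc with rfl | hc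
    · exact ⟨D, hD, fun d hdD => (hr' d hdD).mono (le_max_right _ _)⟩
    · exact hr.mono (le_max_left _ _) c hc

end Points

/-! ### Forcing the operators -/

section Forcing

variable {f : ℕ → ℕ}

/-- A treated requirement has forced its operator to enumerate a pair of disjoint basic open sets:
treating it at stage `t` kills all numbers below `t` on which the two points of the splitting
may differ, at values that are too large to contradict anything used by the splitting. -/
theorem forces_of_act
    (hact : ∀ t, f t = Nat.pair t 0 ∨ (∀ s < t, f s ≠ f t) ∧ ∃ r ≤ t, Splits f r (f t))
    {t e : ℕ} {F τ : List ℕ} (ht : f t = reqCode e F τ) :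
    ∃ p ∈ reqSep e, ∀ C : Set ℕ, (∀ n ∈ F, n ∈ τ ↔ n ∈ C) →
      (∀ k ∈ p.1, k ∈ enumOp (reqOp e) (pointBase f C)) ∧
      (∀ k ∈ p.2, k ∈ enumOp (reqOp e) (pointBase f C)) := by
  classical
  rcases hact t with h | ⟨-, r, hr, q, hq₁, hq₂, hsep, hd₁, hd₂⟩
  · rw [ht] at h
    simp [reqCode, Nat.pair_eq_pair] at h
  · have hlev : lev (f t) = e := by rw [ht, lev_reqCode]
    rw [hlev] at hq₁ hq₂ hsep hd₁ hd₂
    rw [ht, reqCode_inj] at hq₁ hq₂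
    obtain ⟨-, hF, hτ₁⟩ := hq₁
    obtain ⟨-, -, hτ₂⟩ := hq₂
    rw [← hF] at hτ₁ hτ₂
    have key : ∀ (l σ : List ℕ), τ = F.filter (· ∈ l) → Derives f r (reqOp e) {k | k ∈ l} σ →
        ∀ C : Set ℕ, (∀ n ∈ F, n ∈ τ ↔ n ∈ C) →
          ∀ k ∈ σ, k ∈ enumOp (reqOp e) (pointBase f C) := by
      intro l σ hl hder C hC k hk
      obtain ⟨D, hD, hseen⟩ := hder k hk
      refine ⟨D, hD, fun d hd => mem_pointBase.2 ⟨t + 1, ?_⟩⟩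
      obtain ⟨h1, h2, h3⟩ := hseen d hd
      have hn : d.unpair.1 < r := (Nat.unpair_left_le d).trans_lt h1
      have hsurv : ¬ Surv f d.unpair.1 r → ¬ Surv f d.unpair.1 (t + 1) :=
        fun h h' => h (h'.anti (by omega))
      have hagree : (d.unpair.1 ∈ l ↔ d.unpair.1 ∈ C) ∨ ¬ Surv f d.unpair.1 (t + 1) := by
        by_cases hs : Surv f d.unpair.1 r
        · by_cases he : lev (f d.unpair.1) < e
          · have hnF : d.unpair.1 ∈ F := by
              rw [hF, low]
              exact List.mem_filter.2 ⟨List.mem_range.2 hn, by simpa using ⟨hs, he⟩⟩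
            refine Or.inl ?_
            rw [← hC _ hnF, hl]
            simp [hnF]
          · refine Or.inr fun hs' => ?_
            have := hs' t (by omega) (by omega)
            omega
        · exact Or.inr (hsurv hs)
      refine ⟨by omega, h2, h3.imp_right fun h3 => h3.imp (And.imp_right ?_) (And.imp_right ?_)⟩
      · rintro (h | h)
        · exact hagree.imp_left fun H => H.1 h
        · exact Or.inr (hsurv h)
      · rintro (h | h)
        · exact hagree.imp_left fun H h' => h (H.2 h')
        · exact Or.inr (hsurv h)
    exact ⟨q.2, hsep, fun C hC => ⟨key _ _ hτ₁ hd₁ C hC, key _ _ hτ₂ hd₂ C hC⟩⟩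

/-- If two points with the prescribed assignment derive basic open sets that are declared disjoint,
then the corresponding requirement is treated. -/
theorem act_of_split [∀ C : Set ℕ, DecidablePred (· ∈ C)]
    (hcomp : ∀ r j, Splits f r j → ∃ t, f t = j)
    {e : ℕ} {F : List ℕ} {r₀ : ℕ} (hF : ∀ r ≥ r₀, low f r e = F)
    {p : List ℕ × List ℕ} (hp : p ∈ reqSep e) {C C₁ C₂ : Set ℕ}
    (hC₁ : ∀ n ∈ F, n ∈ C ↔ n ∈ C₁) (hC₂ : ∀ n ∈ F, n ∈ C ↔ n ∈ C₂)
    (h₁ : ∀ k ∈ p.1, k ∈ enumOp (reqOp e) (pointBase f C₁))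
    (h₂ : ∀ k ∈ p.2, k ∈ enumOp (reqOp e) (pointBase f C₂)) :
    ∃ t, f t = reqCode e F (F.filter (· ∈ C)) := by
  obtain ⟨r₁, hr₁⟩ := exists_derives h₁
  obtain ⟨r₂, hr₂⟩ := exists_derives h₂
  let r := max r₀ (max r₁ r₂)
  have hlow : low f r e = F := hF r (le_max_left _ _)
  have hFr : ∀ n ∈ F, n < r := by
    intro n hn
    rw [← hlow, low] at hn
    exact List.mem_range.1 (List.mem_filter.1 hn).1
  have hfilter : ∀ C' : Set ℕ, (∀ n ∈ F, n ∈ C ↔ n ∈ C') →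
      F.filter (· ∈ C) = F.filter (· ∈ (List.range r).filter (· ∈ C')) := fun C' hC' =>
    List.filter_congr fun n hn => by simp [hFr n hn, hC' n hn]
  have hder : ∀ (C' : Set ℕ) (σ : List ℕ), Derives f r (reqOp e) C' σ →
      Derives f r (reqOp e) {k | k ∈ (List.range r).filter (· ∈ C')} σ := by
    intro C' σ h k hk
    obtain ⟨D, hD, hd⟩ := h k hk
    exact ⟨D, hD, fun d hdD => (Seen.congr_set fun n hn => by simp [hn]).1 (hd d hdD)⟩
  refine hcomp r _ ⟨(((List.range r).filter (· ∈ C₁), (List.range r).filter (· ∈ C₂)), p), ?_⟩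
  rw [lev_reqCode, hlow, reqCode_inj, reqCode_inj]
  exact ⟨⟨rfl, rfl, hfilter C₁ hC₁⟩, ⟨rfl, rfl, hfilter C₂ hC₂⟩, hp,
    hder _ _ (hr₁.mono ((le_max_left _ _).trans (le_max_right _ _))),
    hder _ _ (hr₂.mono ((le_max_right _ _).trans (le_max_right _ _)))⟩

/-- The sets `C` and `C'` agree below `N`. -/
def AgreeBelow (N : ℕ) (C C' : Set ℕ) : Prop := ∀ n < N, n ∈ C ↔ n ∈ C'

/-- What an operator enumerates from the points attached to the members of a basic clopen set of
assignments is computably enumerable: no information about the surviving numbers is needed, as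
each of them may be sent to `∞` as well as to `∞⋆`. -/
theorem ce_biUnion_enumOp (hf : Primrec f) {Φ : Set (ℕ × List ℕ)} (hΦ : CE Φ) (M : ℕ) (C : Set ℕ) :
    CE {k | ∃ C', AgreeBelow M C C' ∧ k ∈ enumOp Φ (pointBase f C')} := by
  classical
  let l₀ := (List.range M).filter (· ∈ C)
  have hre : REPred fun k : ℕ => ∃ q : (ℕ × List ℕ) × List ℕ, (k, q.2) ∈ Φ ∧
      (∀ a ∈ q.1.2, M ≤ a) ∧
      ∀ d ∈ q.2, Seen (lookup ((List.range q.1.1).map f)) q.1.1 {a | a ∈ l₀ ++ q.1.2} d := by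
    refine REPred.exists (REPred.and (REPred.comp (p := fun q => q ∈ Φ) hΦ
      (Primrec.pair Primrec.fst (Primrec.snd.comp Primrec.snd)))
      (PrimrecPred.rePred (.and ?_ ?_)))
    · exact PrimrecPred.ball_list (Primrec.snd.comp (Primrec.fst.comp Primrec.snd))
        (Primrec.nat_le.comp (Primrec.const M) Primrec.snd)
    · refine PrimrecPred.ball_list (Primrec.snd.comp Primrec.snd) ?_
      have hr : Primrec fun q : (ℕ × ((ℕ × List ℕ) × List ℕ)) × ℕ => q.1.2.1.1 :=
        Primrec.fst.comp (Primrec.fst.comp (Primrec.snd.comp Primrec.fst))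
      exact primrecPred_seen (Primrec.list_map (Primrec.list_range.comp hr)
        (hf.comp Primrec.snd).to₂) hr (Primrec.list_append.comp (Primrec.const l₀)
          (Primrec.snd.comp (Primrec.fst.comp (Primrec.snd.comp Primrec.fst)))) Primrec.snd
  refine hre.of_eq fun k => ?_
  constructor
  · rintro ⟨⟨⟨r, l⟩, D⟩, hD, hl, hs⟩
    refine ⟨{a | a ∈ l₀ ++ l}, fun n hn => ?_, D, hD, forall_mem_pointBase.2 ⟨r, fun d hd => ?_⟩⟩
    · have : n ∉ l := fun h => absurd (hl n h) (by simpa using hn)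
      simp [l₀, hn, this]
    · exact (Seen.congr fun s hs => lookup_map_range f hs).1 (hs d hd)
  · rintro ⟨C', hC', D, hD, hd⟩
    obtain ⟨r, hr⟩ := forall_mem_pointBase.1 hd
    refine ⟨((r, (List.range r).filter fun a => M ≤ a ∧ a ∈ C'), D), hD, by simp +contextual,
      fun d hd => ?_⟩
    refine (Seen.congr fun s hs => lookup_map_range f hs).2 ((Seen.congr_set fun n hn => ?_).1
      (hr d hd))
    by_cases hM : n < M
    · simp [l₀, hM, hC' n hM]
    · simp [l₀, hM, hn, not_lt.1 hM]

/-- Every basic clopen set of assignments contains a smaller one on which `Φ` enumerates the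
neighbourhood filters of computable points only. -/
theorem dense_reducible_ce (hf : Primrec f)
    (hact : ∀ t, f t = Nat.pair t 0 ∨ (∀ s < t, f s ≠ f t) ∧ ∃ r ≤ t, Splits f r (f t))
    (hcomp : ∀ r j, Splits f r j → ∃ t, f t = j)
    {X : Type*} [TopologicalSpace X] {β : ℕ → Set X} (hX : IsEffectiveHausdorff X β)
    {Φ : Set (ℕ × List ℕ)} (hΦ : CE Φ) (N : ℕ) (C : Set ℕ) :
    ∃ C' M, AgreeBelow N C C' ∧ ∀ C'', AgreeBelow M C' C'' →
      ∀ y, Nbase β y = enumOp Φ (pointBase f C'') → CE (Nbase β y) := by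
  classical
  obtain ⟨H, hH, hdiag⟩ := hX.diagonal
  have hsep : ∀ y z, y ≠ z ↔ ∃ p ∈ H, y ∈ basicOpen β p.1 ∧ z ∈ basicOpen β p.2 := by
    intro y z
    have := Set.ext_iff.1 hdiag (y, z)
    simp only [Set.mem_compl_iff, Set.mem_diagonal_iff, Set.mem_iUnion, Set.mem_prod,
      exists_prop] at this
    exact this
  obtain ⟨c, rfl⟩ := hΦ.exists_code
  obtain ⟨c', rfl⟩ := hH.exists_code
  let e := Nat.pair 0 (Nat.pair (Encodable.encode c) (Encodable.encode c'))
  have heΦ : reqOp e = ceSet _ c := by simp [reqOp, e]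
  have heH : reqSep e = ceSet _ c' := by simp [reqSep, e]
  rw [← heΦ] at hΦ ⊢
  rw [← heH] at hsep
  obtain ⟨F, r₀, hF⟩ := exists_low_eq hact e
  let M := max N r₀
  have hFM : ∀ n ∈ F, n < M := by
    intro n hn
    rw [← hF r₀ le_rfl, low] at hn
    exact lt_max_of_lt_right (List.mem_range.1 (List.mem_filter.1 hn).1)
  let τ := F.filter (· ∈ C)
  have hτ : ∀ C', AgreeBelow M C C' → ∀ n ∈ F, n ∈ τ ↔ n ∈ C' := by
    intro C' hC' n hn
    rw [← hC' n (hFM n hn)]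
    simp [τ, hn]
  have hNM : ∀ {C₁ C₂}, AgreeBelow M C₁ C₂ → AgreeBelow N C₁ C₂ :=
    fun h n hn => h n (lt_max_of_lt_left hn)
  by_cases hA : ∃ t, f t = reqCode e F τ
  · -- the operator enumerates two disjoint basic open sets
    obtain ⟨t, ht⟩ := hA
    obtain ⟨p, hp, hforce⟩ := forces_of_act hact ht
    refine ⟨C, M, fun _ _ => Iff.rfl, fun C'' hC'' y hy => ?_⟩
    obtain ⟨h1, h2⟩ := hforce C'' (hτ C'' hC'')
    rw [← hy] at h1 h2
    exact absurd rfl ((hsep y y).2 ⟨p, hp, h1, h2⟩)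
  -- at most one point is reducible to the points with the given assignment
  have huniq : ∀ C₁ C₂, AgreeBelow M C C₁ → AgreeBelow M C C₂ → ∀ y z,
      Nbase β y = enumOp (reqOp e) (pointBase f C₁) →
      Nbase β z = enumOp (reqOp e) (pointBase f C₂) → y = z := by
    intro C₁ C₂ h₁ h₂ y z hy hz
    by_contra hne
    obtain ⟨p, hp, hyp, hzp⟩ := (hsep y z).1 hne
    exact hA (act_of_split hcomp hF hp (fun n hn => h₁ n (hFM n hn)) (fun n hn => h₂ n (hFM n hn))
      (fun k hk => hy.subset (hyp k hk)) (fun k hk => hz.subset (hzp k hk)))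
  by_cases hB : ∃ C₀, AgreeBelow M C C₀ ∧ ∃ y, Nbase β y = enumOp (reqOp e) (pointBase f C₀) ∧
      ¬ CE (Nbase β y)
  · obtain ⟨C₀, hC₀, y, hy, hyce⟩ := hB
    -- some number outside `Nbase β y` can be enumerated, and this excludes `y`
    obtain ⟨k, ⟨C₁, hC₁, D, hD, hd⟩, hky⟩ : ∃ k, (∃ C₁, AgreeBelow M C C₁ ∧
        k ∈ enumOp (reqOp e) (pointBase f C₁)) ∧ k ∉ Nbase β y := by
      by_contra hcon
      push Not at hcon
      refine hyce ((ce_biUnion_enumOp hf hΦ M C).of_eq fun k => ⟨fun h => ?_, fun h => ?_⟩)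
      · obtain ⟨C₁, h1, h2⟩ := h
        exact hcon k ⟨C₁, h1, h2⟩
      · exact ⟨C₀, hC₀, hy ▸ h⟩
    obtain ⟨r, hr⟩ := forall_mem_pointBase.1 hd
    refine ⟨C₁, max M r, hNM hC₁, fun C₂ hC₂ z hz => ?_⟩
    have hC₂' : AgreeBelow M C C₂ := fun n hn =>
      (hC₁ n hn).trans (hC₂ n (lt_max_of_lt_left hn))
    have hzy := huniq _ _ hC₂' hC₀ z y hz hy
    refine absurd ?_ hky
    rw [← hzy, hz]
    exact ⟨D, hD, forall_mem_pointBase.2 ⟨r, fun d hd =>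
      (Seen.congr_set fun n hn => hC₂ n (lt_max_of_lt_right hn)).1 (hr d hd)⟩⟩
  · push Not at hB
    exact ⟨C, M, fun _ _ => Iff.rfl, fun C'' hC'' y hy => hB C'' hC'' y hy⟩

/-- The neighbourhood filter can be kept apart from a given set at a surviving number. -/
theorem dense_pointBase_ne (hinf : ∀ N, ∃ n ≥ N, ∀ m, Surv f n m) (E : Set ℕ) (N : ℕ)
    (C : Set ℕ) :
    ∃ C' M, AgreeBelow N C C' ∧ ∀ C'', AgreeBelow M C' C'' → pointBase f C'' ≠ E := by
  obtain ⟨n, hn, hs⟩ := hinf N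
  have hmem : ∀ C : Set ℕ, Nat.pair n (Nat.pair 1 0) ∈ pointBase f C ↔ n ∈ C := by
    intro C
    rw [mem_pointBase]
    simp only [Seen, Nat.unpair_pair, hs]
    simp only [one_ne_zero, false_and, true_and, not_true_eq_false, or_false, false_or,
      OfNat.one_ne_ofNat]
    exact ⟨fun ⟨_, _, h⟩ => h, fun h => ⟨_, Nat.lt_succ_self _, h⟩⟩
  by_cases hE : Nat.pair n (Nat.pair 1 0) ∈ E
  · refine ⟨C \ {n}, n + 1, fun k hk => ?_, fun C'' hC'' h => ?_⟩
    · simp only [Set.mem_sdiff, Set.mem_singleton_iff]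
      exact ⟨fun h => ⟨h, by omega⟩, fun h => h.1⟩
    · rw [← h, hmem, ← hC'' n (Nat.lt_succ_self n)] at hE
      exact hE.2 rfl
  · refine ⟨C ∪ {n}, n + 1, fun k hk => ?_, fun C'' hC'' h => ?_⟩
    · simp only [Set.mem_union, Set.mem_singleton_iff]
      exact ⟨Or.inl, fun h => h.resolve_right (by omega)⟩
    · rw [← h, hmem, ← hC'' n (Nat.lt_succ_self n)] at hE
      exact hE (Or.inr rfl)

/-- The finite extension method for subsets of `ℕ`. -/
theorem exists_generic_nat {G : ℕ → Set ℕ → Prop}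
    (hG : ∀ k N C, ∃ C' M, AgreeBelow N C C' ∧ ∀ C'', AgreeBelow M C' C'' → G k C'') :
    ∃ C, ∀ k, G k C := by
  choose nx bd h1 h2 using hG
  let seq : ℕ → Set ℕ × ℕ := fun k =>
    Nat.rec (∅, 0) (fun k p => (nx k p.2 p.1, max (p.2 + 1) (bd k p.2 p.1))) k
  have hs : ∀ k, seq (k + 1) = (nx k (seq k).2 (seq k).1,
    max ((seq k).2 + 1) (bd k (seq k).2 (seq k).1)) := fun k => rfl
  have hlt : ∀ k, (seq k).2 < (seq (k + 1)).2 := fun k => by rw [hs]; simp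
  have hmono : StrictMono fun k => (seq k).2 := strictMono_nat_of_lt_succ hlt
  have hag : ∀ {i j}, i ≤ j → AgreeBelow (seq i).2 (seq i).1 (seq j).1 := by
    intro i j hij
    induction j, hij using Nat.le_induction with
    | base => exact fun _ _ => Iff.rfl
    | succ j hij ih =>
      intro n hn
      rw [ih n hn, hs]
      exact h1 j _ _ n (hn.trans_le (hmono.monotone hij))
  refine ⟨{n | n ∈ (seq (n + 1)).1}, fun k => h2 k (seq k).2 (seq k).1 _ fun n hn => ?_⟩
  have hk : n < (seq (k + 1)).2 := by
    rw [hs]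
    exact lt_max_of_lt_right hn
  have hn' : n < (seq (n + 1)).2 := (Nat.lt_succ_self n).trans_le (hmono.le_apply)
  have e1 : n ∈ nx k (seq k).2 (seq k).1 ↔ n ∈ (seq (k + 1)).1 := by rw [hs]
  rw [e1]
  rcases le_total (k + 1) (n + 1) with h | h
  · exact hag h n hk
  · exact (hag h n hn').symm

theorem exists_generic {κ : Type*} [Countable κ] {G : κ → Set ℕ → Prop}
    (hG : ∀ k N C, ∃ C' M, AgreeBelow N C C' ∧ ∀ C'', AgreeBelow M C' C'' → G k C'') :
    ∃ C, ∀ k, G k C := by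
  rcases isEmpty_or_nonempty κ with h | h
  · exact ⟨∅, fun k => h.elim k⟩
  · obtain ⟨s, hs⟩ := exists_surjective_nat κ
    obtain ⟨C, hC⟩ := exists_generic_nat (G := fun n => G (s n)) fun n => hG (s n)
    refine ⟨C, fun k => ?_⟩
    obtain ⟨n, rfl⟩ := hs k
    exact hC n

/-- The enumeration degree of a generic point is quasi-minimal. -/
theorem exists_isQuasiMinimal (hf : Primrec f)
    (hact : ∀ t, f t = Nat.pair t 0 ∨ (∀ s < t, f s ≠ f t) ∧ ∃ r ≤ t, Splits f r (f t))
    (hcomp : ∀ r j, Splits f r j → ∃ t, f t = j)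
    {ι : Type*} [Countable ι] (S : ι → Type*) [∀ i, TopologicalSpace (S i)]
    (β : ∀ i, ℕ → Set (S i)) (hS : ∀ i, IsEffectiveHausdorff (S i) (β i)) :
    ∃ C, IsQuasiMinimal S β (pointBase f C) := by
  obtain ⟨C, hC⟩ := exists_generic (κ := Nat.Partrec.Code ⊕ Nat.Partrec.Code × ι)
    (G := fun k C => match k with
      | .inl c => pointBase f C ≠ ceSet ℕ c
      | .inr (c, i) => CE (ceSet (ℕ × List ℕ) c) → ∀ y,
          Nbase (β i) y = enumOp (ceSet _ c) (pointBase f C) → CE (Nbase (β i) y)) <| by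
    rintro (c | ⟨c, i⟩) N C
    · exact dense_pointBase_ne (exists_surv_ge hact) _ N C
    · by_cases hc : CE (ceSet (ℕ × List ℕ) c)
      · obtain ⟨C', M, h1, h2⟩ := dense_reducible_ce hf hact hcomp (hS i) hc N C
        exact ⟨C', M, h1, fun C'' h _ => h2 C'' h⟩
      · exact ⟨C, N, fun _ _ => Iff.rfl, fun _ _ h => absurd h hc⟩
  refine ⟨C, fun hce => ?_, ?_⟩
  · obtain ⟨c, hc⟩ := hce.exists_code
    exact hC (.inl c) hc
  · rintro i y ⟨Φ, hΦ, hy⟩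
    obtain ⟨c, rfl⟩ := hΦ.exists_code
    exact hC (.inr (c, i)) hΦ y hy

end Forcing

/-! ### Telograph-cototality -/

/-- The index of the condition `x n ∈ Telophase.sub i m`. -/
def triple (n i m : ℕ) : ℕ := Nat.pair n (Nat.pair i m)

theorem triple_mem_Nbase {x : ℕ → Telophase} {n i m : ℕ} :
    triple n i m ∈ Nbase telophasePowerBase x ↔ x n ∈ Telophase.sub i m := by
  simp [triple, Nbase, telophasePowerBase]

theorem Primrec.triple {α : Type*} [Primcodable α] {n i m : α → ℕ} (hn : Primrec n)
    (hi : Primrec i) (hm : Primrec m) : Primrec fun a => triple (n a) (i a) (m a) :=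
  Primrec₂.natPair.comp hn (Primrec₂.natPair.comp hi hm)

theorem two_mul_mem_setJoin {A B : Set ℕ} {n : ℕ} : 2 * n ∈ setJoin A B ↔ n ∈ A := by
  constructor
  · rintro (⟨k, hk, h⟩ | ⟨k, hk, h⟩)
    · rwa [show n = k by omega]
    · omega
  · exact fun h => Or.inl ⟨n, h, rfl⟩

theorem two_mul_add_one_mem_setJoin {A B : Set ℕ} {n : ℕ} :
    2 * n + 1 ∈ setJoin A B ↔ n ∈ B := by
  constructor
  · rintro (⟨k, hk, h⟩ | ⟨k, hk, h⟩)
    · omega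
    · rwa [show n = k by omega]
  · exact fun h => Or.inr ⟨n, h, rfl⟩

theorem pair_mem_graphSet {g : ℕ → ℕ} {n j : ℕ} : Nat.pair n j ∈ graphSet g ↔ j = g n := by
  simp [graphSet, Nat.pair_eq_pair]

theorem pair_mem_telograph {g : ℕ → ℕ} {b n j : ℕ} :
    Nat.pair n j ∈ telograph b g ↔ j = g n ∧ b ≤ j := by
  simp only [telograph, Set.mem_ofPred_eq, Nat.pair_eq_pair]
  constructor
  · rintro ⟨_, ⟨rfl, h⟩, hb⟩
    exact ⟨h, h ▸ hb⟩
  · rintro ⟨h, hb⟩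
    exact ⟨n, ⟨rfl, h⟩, h ▸ hb⟩

/-- Points of the telophase space as natural numbers: `∞` and `∞⋆` are moved in front of `ω`. -/
def Telophase.code : Telophase → ℕ
  | .inf => 0
  | .infStar => 1
  | .fin k => k + 2

theorem enumLE_of_primrecRel {A B : Set ℕ} {R : ℕ → List ℕ → Prop} (hR : PrimrecRel R)
    (h : ∀ n, n ∈ A ↔ ∃ D, R n D ∧ ∀ k ∈ D, k ∈ B) : EnumLE A B :=
  ⟨{q | R q.1 q.2}, PrimrecPred.rePred hR, Set.ext h⟩

theorem Nbase_enumLE_telograph (x : ℕ → Telophase) :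
    EnumLE (Nbase telophasePowerBase x)
      (setJoin (graphSet fun n => (x n).code)ᶜ (telograph 2 fun n => (x n).code)) := by
  let F : ℕ → List ℕ := fun e =>
    if e.unpair.2.unpair.1 = 0 then [2 * Nat.pair e.unpair.1 (e.unpair.2.unpair.2 + 2) + 1]
    else if e.unpair.2.unpair.1 = 1 then
      (List.range (e.unpair.2.unpair.2 + 1)).map fun j => 2 * Nat.pair e.unpair.1 (j + 1)
    else 2 * Nat.pair e.unpair.1 0 ::
      (List.range e.unpair.2.unpair.2).map fun j => 2 * Nat.pair e.unpair.1 (j + 2)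
  have hn : Primrec fun e : ℕ => e.unpair.1 := Primrec.fst.comp Primrec.unpair
  have hu : Primrec fun e : ℕ => e.unpair.2.unpair :=
    Primrec.unpair.comp (Primrec.snd.comp Primrec.unpair)
  have hi := Primrec.fst.comp hu
  have hm := Primrec.snd.comp hu
  have h2 : ∀ {α : Type} [Primcodable α] {n j : α → ℕ}, Primrec n → Primrec j →
      Primrec fun a => 2 * Nat.pair (n a) (j a) := fun hn hj =>
    Primrec.nat_mul.comp (Primrec.const 2) (Primrec₂.natPair.comp hn hj)
  have hadd : ∀ {α : Type} [Primcodable α] {n : α → ℕ} (k : ℕ), Primrec n →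
      Primrec fun a => n a + k := fun k hn => Primrec.nat_add.comp hn (Primrec.const k)
  have hF : Primrec F := by
    refine Primrec.ite (Primrec.eq.comp hi (Primrec.const 0)) ?_
      (Primrec.ite (Primrec.eq.comp hi (Primrec.const 1)) ?_ ?_)
    · exact Primrec.list_cons.comp (hadd 1 (h2 hn (hadd 2 hm))) (Primrec.const [])
    · exact Primrec.list_map (Primrec.list_range.comp (hadd 1 hm))
        (h2 (hn.comp Primrec.fst) (hadd 1 Primrec.snd)).to₂
    · exact Primrec.list_cons.comp (h2 hn (Primrec.const 0))
        (Primrec.list_map (Primrec.list_range.comp hm)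
          (h2 (hn.comp Primrec.fst) (hadd 2 Primrec.snd)).to₂)
  refine enumLE_of_primrecRel (R := fun e D => e.unpair.2.unpair.1 < 3 ∧ D = F e)
    ((Primrec.nat_lt.comp (hi.comp Primrec.fst) (Primrec.const 3)).and
      (Primrec.eq.comp Primrec.snd (hF.comp Primrec.fst))) fun e => ?_
  obtain ⟨n, i, m, rfl⟩ : ∃ n i m, e = triple n i m :=
    ⟨e.unpair.1, e.unpair.2.unpair.1, e.unpair.2.unpair.2, by simp [triple]⟩
  have hR : ∀ Q : List ℕ → Prop, (∃ D, ((triple n i m).unpair.2.unpair.1 < 3 ∧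
      D = F (triple n i m)) ∧ Q D) ↔ i < 3 ∧ Q (F (triple n i m)) := by
    intro Q
    simp only [triple, Nat.unpair_pair]
    exact ⟨fun ⟨D, ⟨h, hD⟩, hQ⟩ => ⟨h, hD ▸ hQ⟩, fun ⟨h, hQ⟩ => ⟨_, ⟨h, rfl⟩, hQ⟩⟩
  rw [triple_mem_Nbase, hR]
  simp only [F, triple, Nat.unpair_pair]
  rcases i with _ | _ | _ | i
  · simp only [Telophase.sub, if_true, List.mem_singleton, forall_eq,
      two_mul_add_one_mem_setJoin, pair_mem_telograph, Set.mem_singleton_iff]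
    cases x n <;> simp [Telophase.code, eq_comm]
  · simp only [Telophase.sub, zero_add, one_ne_zero, if_false, if_true, List.mem_map,
      List.mem_range, forall_exists_index, and_imp, forall_apply_eq_imp_iff₂, two_mul_mem_setJoin,
      Set.mem_compl_iff, pair_mem_graphSet, Set.mem_ofPred_eq]
    cases x n with
    | fin k =>
      simp only [Telophase.code, reduceCtorEq, false_or, Telophase.fin.injEq]
      constructor
      · rintro ⟨_, h, rfl⟩
        exact ⟨by omega, fun j hj => by omega⟩
      · rintro ⟨-, h⟩
        refine ⟨k, ?_, rfl⟩
        by_contra hk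
        exact h (k + 1) (by omega) rfl
    | inf => simp [Telophase.code]
    | infStar =>
      simp only [Telophase.code, reduceCtorEq, and_false, exists_false, or_false, false_iff]
      rintro ⟨-, h⟩
      exact h 0 (by omega) rfl
  · simp only [Telophase.sub, zero_add, Nat.reduceAdd, OfNat.ofNat_ne_zero, OfNat.ofNat_ne_one,
      if_false, List.mem_cons, List.mem_map, List.mem_range, Set.mem_ofPred_eq]
    simp only [forall_eq_or_imp, forall_exists_index, and_imp,
      forall_apply_eq_imp_iff₂, two_mul_mem_setJoin, Set.mem_compl_iff, pair_mem_graphSet]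
    cases x n with
    | fin k =>
      simp only [Telophase.code, reduceCtorEq, false_or, Telophase.fin.injEq]
      constructor
      · rintro ⟨_, h, rfl⟩
        exact ⟨by omega, not_false, fun j hj => by omega⟩
      · rintro ⟨-, -, h⟩
        refine ⟨k, ?_, rfl⟩
        by_contra hk
        exact h k (by omega) rfl
    | inf => simp [Telophase.code]
    | infStar => simp [Telophase.code]
  · simp [Telophase.sub]

theorem telograph_enumLE_Nbase (x : ℕ → Telophase) :
    EnumLE (setJoin (graphSet fun n => (x n).code)ᶜ (telograph 2 fun n => (x n).code))
      (Nbase telophasePowerBase x) := by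
  let R : ℕ → ℕ → List ℕ → Prop := fun p a D =>
    p = 1 ∧ 2 ≤ a.unpair.2 ∧ D = [triple a.unpair.1 0 (a.unpair.2 - 2)] ∨
    p = 0 ∧ (a.unpair.2 = 0 ∧ D = [triple a.unpair.1 2 0] ∨
      a.unpair.2 = 1 ∧ D = [triple a.unpair.1 1 0] ∨
      2 ≤ a.unpair.2 ∧ (D = [triple a.unpair.1 1 (a.unpair.2 - 1)] ∨
        D = [triple a.unpair.1 2 (a.unpair.2 - 1)] ∨
        ∃ i < a.unpair.2 - 2, D = [triple a.unpair.1 0 i]))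
  have hR : PrimrecRel fun k D => R (k % 2) (k / 2) D := by
    have hp : Primrec fun q : ℕ × List ℕ => q.1 % 2 :=
      Primrec.nat_mod.comp Primrec.fst (Primrec.const 2)
    have hu : Primrec fun q : ℕ × List ℕ => (q.1 / 2).unpair :=
      Primrec.unpair.comp (Primrec.nat_div.comp Primrec.fst (Primrec.const 2))
    have hn := Primrec.fst.comp hu
    have hj := Primrec.snd.comp hu
    have hsub : ∀ c, Primrec fun q : ℕ × List ℕ => (q.1 / 2).unpair.2 - c := fun c =>
      Primrec.nat_sub.comp hj (Primrec.const c)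
    have hge : PrimrecPred fun q : ℕ × List ℕ => 2 ≤ (q.1 / 2).unpair.2 :=
      Primrec.nat_le.comp (Primrec.const 2) hj
    have hD : ∀ {α : Type} [Primcodable α] {D : α → List ℕ} {n m : α → ℕ} (i : ℕ), Primrec D →
        Primrec n → Primrec m → PrimrecPred fun a => D a = [triple (n a) i (m a)] :=
      fun i hD hn hm => Primrec.eq.comp hD (Primrec.list_cons.comp
        (Primrec.triple hn (Primrec.const i) hm) (Primrec.const []))
    refine .or (.and (Primrec.eq.comp hp (Primrec.const 1)) (hge.and
        (hD 0 Primrec.snd hn (hsub 2))))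
      (.and (Primrec.eq.comp hp (Primrec.const 0)) (.or
        (.and (Primrec.eq.comp hj (Primrec.const 0)) (hD 2 Primrec.snd hn (Primrec.const 0))) (.or
        (.and (Primrec.eq.comp hj (Primrec.const 1)) (hD 1 Primrec.snd hn (Primrec.const 0)))
        (hge.and (.or (hD 1 Primrec.snd hn (hsub 1)) (.or (hD 2 Primrec.snd hn (hsub 1))
          (.bex_lt (hsub 2) (hD 0 (Primrec.snd.comp Primrec.fst) (hn.comp Primrec.fst)
            Primrec.snd))))))))
  refine enumLE_of_primrecRel hR fun k => ?_
  obtain ⟨n, j, hk⟩ : ∃ n j, k = 2 * Nat.pair n j ∨ k = 2 * Nat.pair n j + 1 :=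
    ⟨(k / 2).unpair.1, (k / 2).unpair.2, by rw [Nat.pair_unpair]; omega⟩
  rcases hk with rfl | rfl
  · rw [two_mul_mem_setJoin, Set.mem_compl_iff, pair_mem_graphSet]
    rw [show 2 * Nat.pair n j % 2 = 0 by omega, show 2 * Nat.pair n j / 2 = Nat.pair n j by omega]
    simp only [R, Nat.unpair_pair, zero_ne_one, false_and, false_or, true_and]
    rcases j with _ | _ | j
    · simp only [true_and, zero_ne_one, false_and, or_false,
        nonpos_iff_eq_zero, OfNat.ofNat_ne_zero, exists_eq_left, List.mem_singleton, forall_eq,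
        triple_mem_Nbase, Telophase.sub]
      cases x n <;> simp [Telophase.code]
    · simp only [zero_add, one_ne_zero, true_and, false_and, false_or, Nat.not_ofNat_le_one,
        or_false, exists_eq_left, List.mem_singleton, forall_eq, triple_mem_Nbase, Telophase.sub]
      cases x n <;> simp [Telophase.code]
    · constructor
      · intro h
        cases hx : x n with
        | inf =>
          refine ⟨[triple n 1 (j + 1)], Or.inr (Or.inr ⟨by omega, Or.inl (by simp)⟩), ?_⟩
          simp [triple_mem_Nbase, Telophase.sub, hx]
        | infStar =>
          refine ⟨[triple n 2 (j + 1)], Or.inr (Or.inr ⟨by omega, Or.inr (Or.inl (by simp))⟩), ?_⟩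
          simp [triple_mem_Nbase, Telophase.sub, hx]
        | fin l =>
          rw [hx, Telophase.code] at h
          rcases lt_or_ge l j with hl | hl
          · refine ⟨[triple n 0 l], Or.inr (Or.inr ⟨by omega, Or.inr (Or.inr ⟨l, by omega, rfl⟩)⟩),
              ?_⟩
            simp [triple_mem_Nbase, Telophase.sub, hx]
          · refine ⟨[triple n 1 (j + 1)], Or.inr (Or.inr ⟨by omega, Or.inl (by simp)⟩), ?_⟩
            simp only [List.mem_singleton, forall_eq, triple_mem_Nbase, Telophase.sub, hx]
            exact Or.inr ⟨l, by omega, rfl⟩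
      · rintro ⟨D, ⟨h, -⟩ | ⟨h, -⟩ | ⟨-, rfl | rfl | ⟨i, hi, rfl⟩⟩, hD⟩ hj
        · omega
        · omega
        all_goals
          simp only [List.mem_singleton, forall_eq, triple_mem_Nbase, Telophase.sub] at hD
          cases hx : x n <;> simp [hx, Telophase.code] at hD hj
        all_goals omega
  · rw [two_mul_add_one_mem_setJoin, pair_mem_telograph]
    rw [show (2 * Nat.pair n j + 1) % 2 = 1 by omega,
      show (2 * Nat.pair n j + 1) / 2 = Nat.pair n j by omega]
    simp only [R, Nat.unpair_pair, one_ne_zero, false_and, or_false, true_and]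
    constructor
    · rintro ⟨h, hj⟩
      refine ⟨_, ⟨hj, rfl⟩, ?_⟩
      simp only [List.mem_singleton, forall_eq, triple_mem_Nbase, Telophase.sub,
        Set.mem_singleton_iff]
      cases hx : x n <;> simp [hx, Telophase.code] at h ⊢
      all_goals omega
    · rintro ⟨D, ⟨hj, rfl⟩, hD⟩
      simp only [List.mem_singleton, forall_eq, triple_mem_Nbase, Telophase.sub,
        Set.mem_singleton_iff] at hD
      rw [hD, Telophase.code]
      omega

theorem isTelographCototal_Nbase (x : ℕ → Telophase) :
    IsTelographCototal (Nbase telophasePowerBase x) :=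
  ⟨_, 2, Nbase_enumLE_telograph x, telograph_enumLE_Nbase x⟩

/-! ### Separating classes -/

section Separation

variable {f : ℕ → ℕ}

/-- The surviving numbers, on which the coordinates of the attached points are infinite. -/
def survivors (f : ℕ → ℕ) : Set ℕ := {n | ∀ m, Surv f n m}

theorem triple_one_zero_mem_pointBase {C : Set ℕ} {n : ℕ} :
    triple n 1 0 ∈ pointBase f C ↔ n ∈ survivors f → n ∈ C := by
  rw [triple_mem_Nbase]
  by_cases h : ∃ m, ¬ Surv f n m
  · have hn : n ∉ survivors f := fun h' => h.elim fun m hm => hm (h' m)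
    simp [point, h, hn, Telophase.sub]
  · have hn : n ∈ survivors f := by simpa [survivors] using h
    by_cases hC : n ∈ C <;> simp [point, h, hn, hC, Telophase.sub]

theorem triple_two_zero_mem_pointBase {C : Set ℕ} {n : ℕ} :
    triple n 2 0 ∈ pointBase f C ↔ n ∈ survivors f → n ∉ C := by
  rw [triple_mem_Nbase]
  by_cases h : ∃ m, ¬ Surv f n m
  · have hn : n ∉ survivors f := fun h' => h.elim fun m hm => hm (h' m)
    simp [point, h, hn, Telophase.sub]
  · have hn : n ∈ survivors f := by simpa [survivors] using h
    by_cases hC : n ∈ C <;> simp [point, h, hn, hC, Telophase.sub]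

theorem mem_sepSets_survivors {C C' : Set ℕ} :
    C' ∈ SepSets (survivors f ∩ C) (survivors f \ C) ↔ ∀ n ∈ survivors f, n ∈ C ↔ n ∈ C' := by
  constructor
  · rintro ⟨h1, h2⟩ n hn
    refine ⟨fun h => h1 ⟨hn, h⟩, fun h => ?_⟩
    by_contra hC
    exact (Set.ext_iff.1 h2 n).1 ⟨⟨hn, hC⟩, h⟩
  · intro h
    refine ⟨fun n hn => (h n hn.1).1 hn.2, Set.eq_empty_of_forall_notMem fun n hn => ?_⟩
    exact hn.1.2 ((h n hn.1.1).2 hn.2)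

theorem pointBase_congr {C C' : Set ℕ} (h : ∀ n ∈ survivors f, n ∈ C ↔ n ∈ C') :
    pointBase f C' = pointBase f C := by
  have : point f C' = point f C := by
    funext n
    by_cases hn : ∃ m, ¬ Surv f n m
    · rw [point, dif_pos hn, point, dif_pos hn]
    · have hn' : n ∈ survivors f := by simpa [survivors] using hn
      rw [point, dif_neg hn, point, dif_neg hn]
      by_cases hC : n ∈ C
      · rw [if_pos hC, if_pos ((h n hn').1 hC)]
      · rw [if_neg hC, if_neg fun h' => hC ((h n hn').2 h')]
  rw [pointBase, this]

theorem ce_compl_survivors (hf : Primrec f) : CE (survivors f)ᶜ := by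
  have : PrimrecRel fun n m => ¬ Surv (lookup ((List.range (n + m)).map f)) n m := by
    refine (primrecPred_surv (Primrec.list_map (Primrec.list_range.comp
      (Primrec.nat_add.comp Primrec.fst Primrec.snd)) (hf.comp Primrec.snd).to₂)
      Primrec.fst Primrec.snd).not
  refine this.rePred_exists.of_eq fun n => ?_
  simp only [survivors, Set.mem_compl_iff, Set.mem_ofPred_eq, not_forall]
  refine exists_congr fun m => not_congr (Surv.congr (fun s hs => lookup_map_range f hs) ?_)
  omega

theorem charFun_eq_one {C : Set ℕ} {n : ℕ} : charFun C n = 1 ↔ n ∈ C := by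
  by_cases h : n ∈ C <;> simp [charFun, h]

/-- A separating set enumerates the neighbourhood filter: the output at `⟨d, r⟩` is `d`, if `d` is
seen by stage `r`, and a fixed member of the filter otherwise. -/
theorem medvedevLE_enum_sepSets (hf : Primrec f) (C : Set ℕ) :
    MedvedevLE (Enum (pointBase f C))
      (charFun '' SepSets (survivors f ∩ C) (survivors f \ C)) := by
  classical
  obtain ⟨d₀, hd₀⟩ : (pointBase f C).Nonempty := by
    by_cases h : 0 ∈ C
    · exact ⟨_, triple_one_zero_mem_pointBase.2 fun _ => h⟩
    · exact ⟨_, triple_two_zero_mem_pointBase.2 fun _ => h⟩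
  let S : List ℕ → ℕ → Prop := fun σ d => Seen (lookup ((List.range σ.length).map f)) σ.length
    {a | a ∈ (List.range σ.length).filter fun a => lookup σ a = 1} d
  have hS : PrimrecRel S := by
    have hlen : Primrec fun q : List ℕ × ℕ => q.1.length := Primrec.list_length.comp Primrec.fst
    refine primrecPred_seen (Primrec.list_map (Primrec.list_range.comp hlen)
      (hf.comp Primrec.snd).to₂) hlen ?_ Primrec.snd
    exact (PrimrecRel.listFilter (R := fun (a : ℕ) (σ : List ℕ) => lookup σ a = 1)
      (Primrec.eq.comp (primrec_lookup.comp Primrec.snd Primrec.fst) (Primrec.const 1))).comp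
      (Primrec.list_range.comp hlen) Primrec.fst
  refine ⟨{q | q.1.length = q.2.1.unpair.2 ∧ (S q.1 q.2.1.unpair.1 ∧ q.2.1.unpair.1 = q.2.2 ∨
    ¬ S q.1 q.2.1.unpair.1 ∧ d₀ = q.2.2)}, ?_, ?_⟩
  · have hu : Primrec fun q : List ℕ × ℕ × ℕ => q.2.1.unpair :=
      Primrec.unpair.comp (Primrec.fst.comp Primrec.snd)
    have hm : Primrec fun q : List ℕ × ℕ × ℕ => q.2.2 := Primrec.snd.comp Primrec.snd
    have hSd : PrimrecPred fun q : List ℕ × ℕ × ℕ => S q.1 q.2.1.unpair.1 :=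
      PrimrecRel.comp hS Primrec.fst (Primrec.fst.comp hu)
    exact PrimrecPred.rePred (.and (Primrec.eq.comp (Primrec.list_length.comp Primrec.fst)
      (Primrec.snd.comp hu)) (.or (hSd.and (Primrec.eq.comp (Primrec.fst.comp hu) hm))
        (hSd.not.and (Primrec.eq.comp (Primrec.const d₀) hm))))
  · rintro _ ⟨C', hC', rfl⟩
    have hN := pointBase_congr (mem_sepSets_survivors.1 hC')
    have hSeen : ∀ r d, S ((List.range r).map (charFun C')) d ↔ Seen f r C' d := by
      intro r d
      simp only [S, List.length_map, List.length_range]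
      refine (Seen.congr fun s hs => lookup_map_range f hs).trans (Seen.congr_set fun n hn => ?_)
      simp only [Set.mem_ofPred_eq, List.mem_filter, List.mem_range, hn, true_and,
        decide_eq_true_eq, lookup_map_range _ hn, charFun_eq_one]
    refine ⟨fun n => if Seen f n.unpair.2 C' n.unpair.1 then n.unpair.1 else d₀, ?_, ?_⟩
    · refine Set.Subset.antisymm ?_ fun d hd => ?_
      · rintro _ ⟨n, rfl⟩
        dsimp only
        split_ifs with h
        · rw [← hN]
          exact mem_pointBase.2 ⟨_, h⟩
        · exact hd₀
      · rw [← hN] at hd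
        obtain ⟨r, hr⟩ := mem_pointBase.1 hd
        exact ⟨Nat.pair d r, by simp [hr]⟩
    · intro n m
      have : ∀ k : ℕ, (((List.range k).map (charFun C'), n, m) ∈ {q : List ℕ × ℕ × ℕ |
          q.1.length = q.2.1.unpair.2 ∧ (S q.1 q.2.1.unpair.1 ∧ q.2.1.unpair.1 = q.2.2 ∨
          ¬ S q.1 q.2.1.unpair.1 ∧ d₀ = q.2.2)}) ↔ k = n.unpair.2 ∧
          (Seen f k C' n.unpair.1 ∧ n.unpair.1 = m ∨ ¬ Seen f k C' n.unpair.1 ∧ d₀ = m) := by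
        intro k
        rw [Set.mem_ofPred_eq, hSeen, List.length_map, List.length_range]
      simp only [this, exists_eq_left]
      by_cases h : Seen f n.unpair.2 C' n.unpair.1 <;> simp [h]

/-- An enumeration of the neighbourhood filter computes a separating set: whether `n` belongs to it
depends on which of the conditions `x n ∈ [0, ∞]` and `x n ∈ [0, ∞⋆]` is listed first. -/
theorem medvedevLE_sepSets_enum (C : Set ℕ) :
    MedvedevLE (charFun '' SepSets (survivors f ∩ C) (survivors f \ C))
      (Enum (pointBase f C)) := by
  classical
  refine ⟨{q | triple q.2.1 1 0 ∈ q.1 ∧ triple q.2.1 2 0 ∉ q.1 ∧ q.2.2 = 1 ∨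
    triple q.2.1 2 0 ∈ q.1 ∧ triple q.2.1 1 0 ∉ q.1 ∧ q.2.2 = 0}, ?_, ?_⟩
  · have hmem : ∀ i, PrimrecPred fun q : List ℕ × ℕ × ℕ => triple q.2.1 i 0 ∈ q.1 := fun i =>
      PrimrecPred.mem_list (Primrec.triple (Primrec.fst.comp Primrec.snd) (Primrec.const i)
        (Primrec.const 0)) Primrec.fst
    have heq : ∀ c, PrimrecPred fun q : List ℕ × ℕ × ℕ => q.2.2 = c := fun c =>
      Primrec.eq.comp (Primrec.snd.comp Primrec.snd) (Primrec.const c)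
    exact PrimrecPred.rePred (.or ((hmem 1).and ((hmem 2).not.and (heq 1)))
      ((hmem 2).and ((hmem 1).not.and (heq 0))))
  · intro p hp
    have hp : Set.range p = pointBase f C := hp
    let L : ℕ → List ℕ := fun k => (List.range k).map p
    have hL : ∀ d k, d ∈ L k ↔ ∃ s < k, p s = d := fun d k => by simp [L]
    have hmono : ∀ {d k l}, k ≤ l → d ∈ L k → d ∈ L l := fun hkl h => by
      rw [hL] at h ⊢
      obtain ⟨s, hs, rfl⟩ := h
      exact ⟨s, by omega, rfl⟩
    have hmemL : ∀ {d k}, d ∈ L k → d ∈ pointBase f C := fun h => by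
      obtain ⟨s, -, rfl⟩ := (hL _ _).1 h
      rw [← hp]
      exact ⟨s, rfl⟩
    have hLmem : ∀ {d}, d ∈ pointBase f C → ∃ k, d ∈ L k := fun h => by
      rw [← hp] at h
      obtain ⟨s, rfl⟩ := h
      exact ⟨s + 1, (hL _ _).2 ⟨s, by omega, rfl⟩⟩
    let C' : Set ℕ := {n | ∃ k, triple n 1 0 ∈ L k ∧ triple n 2 0 ∉ L k}
    have hne : ∀ n, triple n 1 0 ≠ triple n 2 0 := fun n => by simp [triple, Nat.pair_eq_pair]
    -- the first stage at which one of the two conditions is listed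
    have hfirst : ∀ n, n ∉ C' → ∃ k, triple n 2 0 ∈ L k ∧ triple n 1 0 ∉ L k := by
      intro n hn
      have hex : ∃ k, triple n 1 0 ∈ L k ∨ triple n 2 0 ∈ L k := by
        by_cases h : n ∈ C
        · exact (hLmem (triple_one_zero_mem_pointBase.2 fun _ => h)).imp fun _ => Or.inl
        · exact (hLmem (triple_two_zero_mem_pointBase.2 fun _ => h)).imp fun _ => Or.inr
      have hspec := Nat.find_spec hex
      have hmin := fun {m} => Nat.find_min hex (m := m)
      generalize Nat.find hex = k at hspec hmin
      rcases k with _ | k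
      · simp [L] at hspec
      have hk := hmin (Nat.lt_succ_self k)
      have hsucc : ∀ d, d ∈ L (k + 1) ↔ d ∈ L k ∨ d = p k := fun d => by
        simp [L, List.range_succ]
      rw [not_or] at hk
      by_cases h1 : triple n 1 0 ∈ L (k + 1)
      · refine absurd ⟨k + 1, h1, fun h2 => ?_⟩ hn
        rw [hsucc] at h1 h2
        exact hne n ((h1.resolve_left hk.1).trans (h2.resolve_left hk.2).symm)
      · exact ⟨k + 1, hspec.resolve_left h1, h1⟩
    have hexcl : ∀ n, n ∈ C' → ∀ k, triple n 2 0 ∈ L k → triple n 1 0 ∈ L k := by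
      rintro n ⟨k, h1, h2⟩ l hl
      rcases le_total k l with h | h
      · exact hmono h h1
      · exact absurd (hmono h hl) h2
    refine ⟨charFun C', ⟨C', mem_sepSets_survivors.2 fun n hn => ⟨fun hC => ?_, ?_⟩, rfl⟩, ?_⟩
    · by_contra hn'
      obtain ⟨k, h2, -⟩ := hfirst n hn'
      exact triple_two_zero_mem_pointBase.1 (hmemL h2) hn hC
    · rintro ⟨k, h1, -⟩
      exact triple_one_zero_mem_pointBase.1 (hmemL h1) hn
    · intro n m
      change _ ↔ ∃ k, (triple n 1 0 ∈ L k ∧ triple n 2 0 ∉ L k ∧ m = 1 ∨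
        triple n 2 0 ∈ L k ∧ triple n 1 0 ∉ L k ∧ m = 0)
      by_cases hn : n ∈ C'
      · have h1 : charFun C' n = 1 := charFun_eq_one.2 hn
        rw [h1]
        constructor
        · rintro rfl
          obtain ⟨k, h⟩ := hn
          exact ⟨k, Or.inl ⟨h.1, h.2, rfl⟩⟩
        · rintro ⟨k, ⟨-, -, h⟩ | ⟨h, h', -⟩⟩
          · exact h.symm
          · exact absurd (hexcl n hn k h) h'
      · have h0 : charFun C' n = 0 := by simp [charFun, hn]
        rw [h0]
        constructor
        · rintro rfl
          obtain ⟨k, h⟩ := hfirst n hn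
          exact ⟨k, Or.inr ⟨h.1, h.2, rfl⟩⟩
        · rintro ⟨k, ⟨h, h', -⟩ | ⟨-, -, h⟩⟩
          · exact absurd ⟨k, h, h'⟩ hn
          · exact h.symm

/-- A finite part of a separating set can be certified by the neighbourhood filter, so whatever all
separating sets enumerate uniformly is enumeration reducible to the filter. -/
theorem SepEnumerates.enumLE_pointBase {C E : Set ℕ}
    (h : SepEnumerates (survivors f ∩ C) (survivors f \ C) E) : EnumLE E (pointBase f C) := by
  obtain ⟨Φ, hΦ, hE⟩ := h
  obtain ⟨g, hg, hg0, hg1⟩ : ∃ g : ℕ → ℕ, Primrec g ∧ (∀ k, g (2 * k) = triple k 1 0) ∧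
      ∀ k, g (2 * k + 1) = triple k 2 0 := by
    refine ⟨fun a => triple (a / 2) (1 + a % 2) 0, ?_, fun k => ?_, fun k => ?_⟩
    · exact Primrec.triple (Primrec.nat_div.comp Primrec.id (Primrec.const 2))
        (Primrec.nat_add.comp (Primrec.const 1)
          (Primrec.nat_mod.comp Primrec.id (Primrec.const 2))) (Primrec.const 0)
    · simp
    · dsimp only
      rw [show (2 * k + 1) / 2 = k by omega, show 1 + (2 * k + 1) % 2 = 2 by omega]
  have hpar : ∀ a, ∃ k, a = 2 * k ∨ a = 2 * k + 1 := fun a => ⟨a / 2, by omega⟩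
  refine ⟨{q | ∃ D, (q.1, D) ∈ Φ ∧ (∀ a ∈ D, ∀ b ∈ D, ¬ (a % 2 = 0 ∧ b = a + 1)) ∧
    q.2 = D.map g}, ?_, ?_⟩
  · refine REPred.exists (REPred.and (REPred.comp (p := fun q => q ∈ Φ) hΦ
      (Primrec.pair (Primrec.fst.comp Primrec.fst) Primrec.snd))
      (PrimrecPred.rePred (.and ?_ ?_)))
    · refine .ball_list Primrec.snd (.ball_list (Primrec.snd.comp Primrec.fst)
        (PrimrecPred.not (.and ?_ ?_)))
      · exact Primrec.eq.comp (Primrec.nat_mod.comp (Primrec.snd.comp Primrec.fst)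
          (Primrec.const 2)) (Primrec.const 0)
      · exact Primrec.eq.comp Primrec.snd (Primrec.succ.comp (Primrec.snd.comp Primrec.fst))
    · exact Primrec.eq.comp (Primrec.snd.comp Primrec.fst)
        (Primrec.list_map Primrec.snd (hg.comp Primrec.snd).to₂)
  · ext n
    constructor
    · intro hn
      rw [← hE C (mem_sepSets_survivors.2 fun _ _ => Iff.rfl)] at hn
      obtain ⟨D, hD, hDC⟩ := hn
      refine ⟨D.map g, ⟨D, hD, ?_, rfl⟩, ?_⟩
      · rintro a ha _ hb ⟨hpa, rfl⟩
        obtain ⟨k, rfl | rfl⟩ := hpar a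
        · exact two_mul_add_one_mem_setJoin.1 (hDC _ hb) (two_mul_mem_setJoin.1 (hDC _ ha))
        · omega
      · intro d hd
        obtain ⟨a, ha, rfl⟩ := List.mem_map.1 hd
        obtain ⟨k, rfl | rfl⟩ := hpar a
        · rw [hg0]
          exact triple_one_zero_mem_pointBase.2 fun _ => two_mul_mem_setJoin.1 (hDC _ ha)
        · rw [hg1]
          exact triple_two_zero_mem_pointBase.2 fun _ => two_mul_add_one_mem_setJoin.1 (hDC _ ha)
    · rintro ⟨_, ⟨D, hD, hcons, rfl⟩, hN⟩
      have h1 : ∀ k, 2 * k ∈ D → k ∈ survivors f → k ∈ C := fun k hk =>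
        triple_one_zero_mem_pointBase.1 (hg0 k ▸ hN _ (List.mem_map_of_mem hk))
      have h2 : ∀ k, 2 * k + 1 ∈ D → k ∈ survivors f → k ∉ C := fun k hk =>
        triple_two_zero_mem_pointBase.1 (hg1 k ▸ hN _ (List.mem_map_of_mem hk))
      -- `C`, changed off the surviving numbers as `D` demands
      have hC' : {k | k ∈ C ∧ 2 * k + 1 ∉ D ∨ 2 * k ∈ D} ∈
          SepSets (survivors f ∩ C) (survivors f \ C) := by
        refine mem_sepSets_survivors.2 fun k hk => ⟨fun hC => ?_, ?_⟩
        · exact Or.inl ⟨hC, fun h => h2 k h hk hC⟩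
        · rintro (h | h)
          · exact h.1
          · exact h1 k h hk
      rw [← hE _ hC']
      refine ⟨D, hD, fun a ha => ?_⟩
      obtain ⟨k, rfl | rfl⟩ := hpar a
      · exact two_mul_mem_setJoin.2 (Or.inr ha)
      · refine two_mul_add_one_mem_setJoin.2 ?_
        rintro (h | h)
        · exact h.2 ha
        · exact hcons _ h _ ha ⟨by omega, rfl⟩

end Separation

theorem mainTheorem2 {ι : Type*} [Countable ι] (S : ι → Type*)
    [∀ i, TopologicalSpace (S i)] (β : ∀ i, ℕ → Set (S i))
    (hS : ∀ i, IsEffectiveHausdorff (S i) (β i)) :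
    ∃ (x : ℕ → Telophase) (A B : Set ℕ),
      IsTelographCototal (Nbase telophasePowerBase x) ∧
      IsQuasiMinimal S β (Nbase telophasePowerBase x) ∧
      Disjoint A B ∧ CE (A ∪ B)ᶜ ∧
      MedvedevEquiv (Enum (Nbase telophasePowerBase x)) (charFun '' SepSets A B) ∧
      ∀ (i : ι) (y : S i), SepEnumerates A B (Nbase (β i) y) → CE (Nbase (β i) y) := by
  obtain ⟨f, hf, hact, hcomp⟩ := exists_stages
  obtain ⟨C, hC⟩ := exists_isQuasiMinimal hf hact hcomp S β hS
  refine ⟨point f C, survivors f ∩ C, survivors f \ C, isTelographCototal_Nbase _, hC, ?_, ?_,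
    ⟨medvedevLE_enum_sepSets hf C, medvedevLE_sepSets_enum C⟩,
    fun i y h => hC.2 i y h.enumLE_pointBase⟩
  · exact Set.disjoint_left.2 fun n h1 h2 => h2.2 h1.2
  · rw [Set.inter_union_sdiff]
    exact ce_compl_survivors hf
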